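/- Let $\lambda>0$ and $a=\tfrac12(1+\lambda)\lambda^{\gamma}$ with $\gamma=\frac{1-\lambda}{1+\lambda}$. For $x>0$ and $\nu>0$ put $$\mathcal W^-_{\lambda,\nu}(x)=\Big(\frac x2\Big)^{\nu}\sum_{n=0}^\infty\frac{(-1)^n(x/2)^{(\lambda+1)n}}{n!\,\Gamma(\lambda n+\nu+1)},$$ and put $$h(u)=\tfrac12(e^u-e^{-\lambda u})-au,\qquad u_0=\frac{2\log\lambda}{1+\lambda},\qquad H=\lambda^{2/(1+\lambda)}(1+\lambda).$$ Then $h'(u_0)=h''(u_0)=0$ (so $u_0$ is a double saddle point of $h$), $H=2h'''(u_0)$, and $$h(u_0)=\frac{\lambda^2-1}{2\lambda^2}\,e^{u_0}-\lambda^{\gamma}\log\lambda .$$ There are an analytic function $u=u(w)$ near $w=0$ with $$-\tfrac13w^3=h(u)-h(u_0),\qquad u(0)=u_0,\qquad u'(0)=\frac{2^{2/3}e^{\pi i/3}}{H^{1/3}},$$ and real numbers $B_0,B_1,B_2,\dots$ such that, near $w=0$, $$\frac{du}{dw}=\frac{2^{2/3}}{H^{1/3}}\sum_{k\ge0}\frac{e^{\pi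 i(k+1)/3}B_k}{H^{k/3}}\,w^k .$$ These satisfy $$B_0=1,\quad B_1=\frac{\lambda-1}{2^{1/3}\cdot3},\quad B_2=\frac{1-6\lambda+\lambda^2}{2^{2/3}\cdot20},\quad B_3=\frac{5+93\lambda-93\lambda^2-5\lambda^3}{1620},$$ $$B_4=-\frac{277+836\lambda-6114\lambda^2+836\lambda^3+277\lambda^4}{2^{1/3}\cdot136080},$$ $$B_5=\frac{1-61\lambda-254\lambda^2+254\lambda^3+61\lambda^4-\lambda^5}{2^{2/3}\cdot16800},$$ $$B_6=\frac{959+7098\lambda-2031\lambda^2-58708\lambda^3-2031\lambda^4+7098\lambda^5+959\lambda^6}{10497600}.$$ As $x\to+\infty$ with $\nu=ax$, $$\mathcal W^-_{\lambda,\nu}(x)\sim\frac{2^{2/3}e^{xh(u_0)}}{3\pi(Hx/3)^{1/3}}\sum_{k\ge0}\frac{B_k}{(Hx/3)^{k/3}}\,\Gamma\Big(\frac{k+1}3\Big)\sin\frac{\pi(k+1)}3$$ in the sense of Poincaré: for every integer $N\ge0$, the difference between the left side and the right side with the sum restricted to $0\le k<N$ is $$O\big(e^{xh(u_0)}(Hx/3)^{-(N+1)/3}\big)\qquad(x\to+\infty).$$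 The terms of the series with $k\equiv2\pmod 3$ vanish. -/

import Mathlib

open Filter Topology Asymptotics

noncomputable section

/-- The Wright function `W_{lam, mu}(z) = ∑ z ^ n / (n! Γ(lam n + mu))` for real arguments. -/
def wright (lam mu z : ℝ) : ℝ :=
  ∑' n : ℕ, z ^ n / ((n.factorial : ℝ) * Real.Gamma (lam * n + mu))

/-- `𝒲⁻_{lam, nu}(x) = (x/2) ^ nu * W_{lam, nu + 1}(-(x/2) ^ (lam + 1))`. -/
def wrightMinus (lam nu x : ℝ) : ℝ :=
  (x / 2) ^ nu * wright lam (nu + 1) (-(x / 2) ^ (lam + 1))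

/-- The phase function `h(u) = (e ^ u - e ^ (-lam u)) / 2 - a u`. -/
def phase (lam a : ℝ) (u : ℂ) : ℂ :=
  (Complex.exp u - Complex.exp (-(lam : ℂ) * u)) / 2 - (a : ℂ) * u

/-- The double saddle `u₀ = 2 log lam / (1 + lam)`. -/
def doubleSaddle (lam : ℝ) : ℝ := 2 * Real.log lam / (1 + lam)

/-- The constant `H = lam ^ (2 / (1 + lam)) * (1 + lam)`. -/
def bigH (lam : ℝ) : ℝ := lam ^ (2 / (1 + lam)) * (1 + lam)

/-- The local inverse `u = U(w)` of `-w³/3 = h(u) - h(u₀)` at the double saddle, on the branch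
`u - u₀ = 2^(2/3) e^(πi/3) H^(-1/3) w + ⋯` which for `w > 0` describes the upper half of the path
of steepest descent. -/
structure IsUpperBranch (lam a : ℝ) (U : ℂ → ℂ) : Prop where
  analyticAt : AnalyticAt ℂ U 0
  map_zero : U 0 = (doubleSaddle lam : ℂ)
  deriv_zero : deriv U 0 =
    (((2 : ℝ) ^ (2 / 3 : ℝ) / bigH lam ^ (1 / 3 : ℝ) : ℝ) : ℂ) *
      Complex.exp ((Real.pi : ℂ) * Complex.I / 3)
  phase_eq : ∀ᶠ w in 𝓝 (0 : ℂ),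
    phase lam a (U w) - phase lam a (doubleSaddle lam : ℂ) = -w ^ 3 / 3

/-- The real numbers `B k` are the coefficients in the power series expansion
`du/dw = 2^(2/3) H^(-1/3) ∑ₖ e^(πi(k+1)/3) B k H^(-k/3) w^k`
on the upper branch. -/
def IsSaddleCoeff (lam a : ℝ) (B : ℕ → ℝ) : Prop :=
  ∃ U : ℂ → ℂ, IsUpperBranch lam a U ∧
    ∀ᶠ w in 𝓝 (0 : ℂ), HasSum
      (fun k : ℕ =>
        (((2 : ℝ) ^ (2 / 3 : ℝ) / bigH lam ^ (1 / 3 : ℝ) : ℝ) : ℂ) *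
          (Complex.exp ((Real.pi : ℂ) * Complex.I * ((k : ℂ) + 1) / 3) *
            ((B k / bigH lam ^ ((k : ℝ) / 3) : ℝ) : ℂ) * w ^ k))
      (deriv U w)

/-- The factor `2^(2/3) e^(x h(u₀)) / (3 π (H x / 3)^(1/3))`. -/
def saddlePrefactor (lam a x : ℝ) : ℝ :=
  (2 : ℝ) ^ (2 / 3 : ℝ) * Real.exp (x * (phase lam a (doubleSaddle lam : ℂ)).re) /
    (3 * Real.pi * (bigH lam * x / 3) ^ (1 / 3 : ℝ))

/-- The `k`-th term `B k (H x / 3)^(-k/3) Γ((k+1)/3) sin(π (k+1) / 3)` of the series. -/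
def saddleTerm (lam : ℝ) (B : ℕ → ℝ) (k : ℕ) (x : ℝ) : ℝ :=
  B k / (bigH lam * x / 3) ^ ((k : ℝ) / 3) * Real.Gamma (((k : ℝ) + 1) / 3) *
    Real.sin (Real.pi / 3 * ((k : ℝ) + 1))

end

/-!
Inserting Hankel's integral for `1 / Γ` into the series and summing over `n` gives, for `ν = a x`,
`2 π i 𝒲⁻(x) = ∫ e ^ (x h(u)) du` along a contour symmetric about the real axis, whose upper half
can be taken to start at `u₀` and to go to infinity on the horizontal line of height `π / 2`. Only
the imaginary part of the integral over this half matters.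

Around the double saddle `h(u₀ + t) = h(u₀) + H / 12 * V(t)` with `V(t) = t³ + O(t⁴)`. On the ray of
angle `π / 3` the cube is negative, and in fact `Re V < 0` all the way up to height `π / 2`, from
where `Re V` decreases at least linearly to the right. So the whole integral, up to exponentially
small terms, comes from a neighbourhood of `u₀`, where the local inverse of `V = T³` turns it into
`∫ e ^ (-x w³ / 3) u'(w) dw`, and Watson's lemma gives the expansion.

The map `V` satisfies the linear equation `V'' = (1 - λ) V' + λ V + 6 t`, which yields a recursion
for the Taylor coefficients of `T` and hence the values of the `B k`.
-/

open MeasureTheory Set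
open scoped ComplexConjugate Real

section DoubleSaddle

variable {lam : ℝ}

/-- The ratio `a = ν / x` at which the two saddle points of the phase coalesce. -/
noncomputable def coalescenceRatio (lam : ℝ) : ℝ :=
  (1 + lam) / 2 * lam ^ ((1 - lam) / (1 + lam))

theorem coalescenceRatio_pos (hlam : 0 < lam) : 0 < coalescenceRatio lam := by
  unfold coalescenceRatio; positivity

theorem exp_doubleSaddle (hlam : 0 < lam) :
    Real.exp (doubleSaddle lam) = lam ^ (2 / (1 + lam)) := by
  rw [Real.rpow_def_of_pos hlam, doubleSaddle]
  ring_nf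

theorem exp_neg_mul_doubleSaddle (hlam : 0 < lam) :
    Real.exp (-lam * doubleSaddle lam) = Real.exp (doubleSaddle lam) / lam ^ 2 := by
  have lam_sq : lam ^ 2 = Real.exp (2 * Real.log lam) := by
    rw [two_mul, Real.exp_add, Real.exp_log hlam, sq]
  rw [lam_sq, ← Real.exp_sub, doubleSaddle]
  congr 1
  field_simp
  ring

theorem cexp_neg_mul_doubleSaddle (hlam : 0 < lam) :
    Complex.exp (-(lam : ℂ) * doubleSaddle lam) = Complex.exp (doubleSaddle lam) / lam ^ 2 := by
  exact_mod_cast congrArg ((↑) : ℝ → ℂ) (exp_neg_mul_doubleSaddle hlam)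

theorem coalescenceRatio_eq (hlam : 0 < lam) :
    coalescenceRatio lam = (1 + lam) / (2 * lam) * Real.exp (doubleSaddle lam) := by
  have exponent : (1 - lam) / (1 + lam) = 2 / (1 + lam) - 1 := by field_simp; ring
  rw [coalescenceRatio, exp_doubleSaddle hlam, exponent, Real.rpow_sub_one hlam.ne']
  field_simp

theorem bigH_eq (hlam : 0 < lam) : bigH lam = Real.exp (doubleSaddle lam) * (1 + lam) := by
  rw [bigH, exp_doubleSaddle hlam]

theorem bigH_pos (hlam : 0 < lam) : 0 < bigH lam := by
  unfold bigH; positivity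

theorem hasDerivAt_cexp_const_mul (c u : ℂ) :
    HasDerivAt (fun u => Complex.exp (c * u)) (c * Complex.exp (c * u)) u := by
  simpa [mul_comm] using ((hasDerivAt_id u).const_mul c).cexp

theorem hasDerivAt_phase (lam a : ℝ) (u : ℂ) : HasDerivAt (phase lam a)
    ((Complex.exp u + lam * Complex.exp (-(lam : ℂ) * u)) / 2 - a) u :=
  ((((Complex.hasDerivAt_exp u).sub (hasDerivAt_cexp_const_mul (-lam) u)).div_const 2).sub
    ((hasDerivAt_id u).const_mul (a : ℂ))).congr_deriv (by ring)

theorem differentiable_phase (lam a : ℝ) : Differentiable ℂ (phase lam a) :=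
  fun u => (hasDerivAt_phase lam a u).differentiableAt

theorem deriv_phase (lam a : ℝ) : deriv (phase lam a) =
    fun u => (Complex.exp u + lam * Complex.exp (-(lam : ℂ) * u)) / 2 - a :=
  funext fun u => (hasDerivAt_phase lam a u).deriv

theorem iteratedDeriv_two_phase (lam a : ℝ) : iteratedDeriv 2 (phase lam a) =
    fun u => (Complex.exp u - lam ^ 2 * Complex.exp (-(lam : ℂ) * u)) / 2 := by
  rw [iteratedDeriv_succ, iteratedDeriv_one, deriv_phase]
  exact funext fun u => ((((Complex.hasDerivAt_exp u).add
    ((hasDerivAt_cexp_const_mul (-lam) u).const_mul (lam : ℂ))).div_const 2).sub_const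
      (a : ℂ)).deriv.trans (by ring)

theorem iteratedDeriv_three_phase (lam a : ℝ) : iteratedDeriv 3 (phase lam a) =
    fun u => (Complex.exp u + lam ^ 3 * Complex.exp (-(lam : ℂ) * u)) / 2 := by
  rw [iteratedDeriv_succ, iteratedDeriv_two_phase]
  exact funext fun u => (((Complex.hasDerivAt_exp u).sub
    ((hasDerivAt_cexp_const_mul (-lam) u).const_mul ((lam : ℂ) ^ 2))).div_const 2).deriv.trans
      (by ring)

theorem deriv_phase_doubleSaddle (hlam : 0 < lam) :
    deriv (phase lam (coalescenceRatio lam)) (doubleSaddle lam) = 0 := by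
  simp only [deriv_phase, cexp_neg_mul_doubleSaddle hlam, coalescenceRatio_eq hlam]
  have : (lam : ℂ) ≠ 0 := by exact_mod_cast hlam.ne'
  push_cast
  field_simp
  ring

theorem iteratedDeriv_two_phase_doubleSaddle (hlam : 0 < lam) (a : ℝ) :
    iteratedDeriv 2 (phase lam a) (doubleSaddle lam) = 0 := by
  simp only [iteratedDeriv_two_phase, cexp_neg_mul_doubleSaddle hlam]
  have : (lam : ℂ) ≠ 0 := by exact_mod_cast hlam.ne'
  field_simp
  ring

theorem bigH_eq_two_mul_iteratedDeriv_three_phase (hlam : 0 < lam) (a : ℝ) :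
    (bigH lam : ℂ) = 2 * iteratedDeriv 3 (phase lam a) (doubleSaddle lam) := by
  simp only [iteratedDeriv_three_phase, cexp_neg_mul_doubleSaddle hlam, bigH_eq hlam]
  have : (lam : ℂ) ≠ 0 := by exact_mod_cast hlam.ne'
  push_cast
  field_simp

theorem phase_doubleSaddle (hlam : 0 < lam) :
    phase lam (coalescenceRatio lam) (doubleSaddle lam) =
      (((lam ^ 2 - 1) / (2 * lam ^ 2) * Real.exp (doubleSaddle lam) -
        lam ^ ((1 - lam) / (1 + lam)) * Real.log lam : ℝ) : ℂ) := by
  have linear_part : coalescenceRatio lam * doubleSaddle lam =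
      lam ^ ((1 - lam) / (1 + lam)) * Real.log lam := by
    rw [coalescenceRatio, doubleSaddle]
    field_simp
  rw [phase, cexp_neg_mul_doubleSaddle hlam, ← linear_part]
  have : (lam : ℂ) ≠ 0 := by exact_mod_cast hlam.ne'
  push_cast
  field_simp

theorem phase_ofReal (lam a u : ℝ) : phase lam a u = ((phase lam a u).re : ℂ) := by
  refine (Complex.conj_eq_iff_re.1 ?_).symm
  simp [phase, ← Complex.exp_conj, Complex.conj_ofNat]

theorem phase_conj (lam a : ℝ) (u : ℂ) : phase lam a (conj u) = conj (phase lam a u) := by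
  simp [phase, ← Complex.exp_conj, Complex.conj_ofNat]

end DoubleSaddle

section NormalizedPhase

variable {lam : ℝ}

/-- The phase at coalescence, recentred at the double saddle and rescaled so that its leading term
is `t ^ 3`. -/
noncomputable def normalizedPhase (lam : ℝ) (t : ℂ) : ℂ :=
  6 / (1 + lam) * (Complex.exp t - 1 - (Complex.exp (-(lam : ℂ) * t) - 1) / lam ^ 2
    - (1 + 1 / lam) * t)

theorem phase_doubleSaddle_add (hlam : 0 < lam) (t : ℂ) :
    phase lam (coalescenceRatio lam) (doubleSaddle lam + t) =
      phase lam (coalescenceRatio lam) (doubleSaddle lam) +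
        bigH lam / 12 * normalizedPhase lam t := by
  have lam_ne : (lam : ℂ) ≠ 0 := by exact_mod_cast hlam.ne'
  have one_add_ne : (1 + lam : ℂ) ≠ 0 := by exact_mod_cast (by positivity : 1 + lam ≠ 0)
  simp only [phase, normalizedPhase, mul_add, Complex.exp_add, cexp_neg_mul_doubleSaddle hlam,
    bigH_eq hlam, coalescenceRatio_eq hlam]
  push_cast
  field_simp
  ring

theorem normalizedPhase_eq (hlam : 0 < lam) : normalizedPhase lam = fun t => 12 / bigH lam *
    (phase lam (coalescenceRatio lam) (doubleSaddle lam + t) -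
      phase lam (coalescenceRatio lam) (doubleSaddle lam)) := by
  have : (bigH lam : ℂ) ≠ 0 := by exact_mod_cast (bigH_pos hlam).ne'
  funext t
  rw [phase_doubleSaddle_add hlam]
  field_simp
  ring

theorem normalizedPhase_conj (lam : ℝ) (t : ℂ) :
    normalizedPhase lam (conj t) = conj (normalizedPhase lam t) := by
  simp [normalizedPhase, ← Complex.exp_conj, Complex.conj_ofNat]

theorem differentiable_normalizedPhase (lam : ℝ) : Differentiable ℂ (normalizedPhase lam) := by
  unfold normalizedPhase; fun_prop

theorem iteratedDeriv_normalizedPhase_zero (hlam : 0 < lam) {n : ℕ} (hn : n ≠ 0) :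
    iteratedDeriv n (normalizedPhase lam) 0 =
      12 / bigH lam * iteratedDeriv n (phase lam (coalescenceRatio lam)) (doubleSaddle lam) := by
  obtain ⟨n, rfl⟩ := Nat.exists_eq_succ_of_ne_zero hn
  have deriv_shift (u : ℂ) : deriv (fun t => phase lam (coalescenceRatio lam) (u + t) -
      phase lam (coalescenceRatio lam) u) =
      fun t => deriv (phase lam (coalescenceRatio lam)) (u + t) :=
    funext fun t => by rw [deriv_sub_const, deriv_comp_const_add]
  rw [normalizedPhase_eq hlam, iteratedDeriv_const_mul_field, iteratedDeriv_succ', deriv_shift,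
    iteratedDeriv_comp_const_add, ← iteratedDeriv_succ']
  simp only [add_zero]

theorem iteratedDeriv_normalizedPhase_zero_of_lt_three (hlam : 0 < lam) {n : ℕ} (hn : n < 3) :
    iteratedDeriv n (normalizedPhase lam) 0 = 0 := by
  interval_cases n
  · simp [normalizedPhase]
  · rw [iteratedDeriv_normalizedPhase_zero hlam one_ne_zero, iteratedDeriv_one,
      deriv_phase_doubleSaddle hlam, mul_zero]
  · rw [iteratedDeriv_normalizedPhase_zero hlam two_ne_zero,
      iteratedDeriv_two_phase_doubleSaddle hlam, mul_zero]

theorem iteratedDeriv_three_normalizedPhase_zero (hlam : 0 < lam) :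
    iteratedDeriv 3 (normalizedPhase lam) 0 = 6 := by
  have H_ne : (bigH lam : ℂ) ≠ 0 := by exact_mod_cast (bigH_pos hlam).ne'
  rw [iteratedDeriv_normalizedPhase_zero hlam three_ne_zero, div_mul_eq_mul_div, div_eq_iff H_ne]
  linear_combination -6 * bigH_eq_two_mul_iteratedDeriv_three_phase hlam (coalescenceRatio lam)

theorem deriv_normalizedPhase (hlam : 0 < lam) : deriv (normalizedPhase lam) = fun t =>
    6 / (1 + lam) * (Complex.exp t + Complex.exp (-(lam : ℂ) * t) / lam - (1 + 1 / lam)) := by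
  have lam_ne : (lam : ℂ) ≠ 0 := by exact_mod_cast hlam.ne'
  funext t
  refine (((((Complex.hasDerivAt_exp t).sub_const 1).sub
    (((hasDerivAt_cexp_const_mul (-lam) t).sub_const 1).div_const ((lam : ℂ) ^ 2))).sub
    ((hasDerivAt_id t).const_mul (1 + 1 / (lam : ℂ)))).const_mul
      (6 / (1 + (lam : ℂ)))).deriv.trans ?_
  field_simp
  ring

theorem deriv_deriv_normalizedPhase (hlam : 0 < lam) (t : ℂ) :
    deriv (deriv (normalizedPhase lam)) t =
      (1 - lam) * deriv (normalizedPhase lam) t + lam * normalizedPhase lam t + 6 * t := by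
  have lam_ne : (lam : ℂ) ≠ 0 := by exact_mod_cast hlam.ne'
  have one_add_ne : (1 + lam : ℂ) ≠ 0 := by exact_mod_cast (by positivity : 1 + lam ≠ 0)
  rw [deriv_normalizedPhase hlam]
  refine ((((Complex.hasDerivAt_exp t).add
    ((hasDerivAt_cexp_const_mul (-lam) t).div_const (lam : ℂ))).sub_const
    (1 + 1 / (lam : ℂ))).const_mul (6 / (1 + (lam : ℂ)))).deriv.trans ?_
  rw [normalizedPhase]
  field_simp
  ring

theorem re_normalizedPhase (lam ρ θ : ℝ) : (normalizedPhase lam (ρ + θ * Complex.I)).re =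
    6 / (1 + lam) * (Real.exp ρ * Real.cos θ - 1
      - (Real.exp (-lam * ρ) * Real.cos (lam * θ) - 1) / lam ^ 2 - (1 + 1 / lam) * ρ) := by
  have real_coefficients : normalizedPhase lam (ρ + θ * Complex.I) = ((6 / (1 + lam) : ℝ) : ℂ) *
      (Complex.exp (ρ + θ * Complex.I) - 1 -
        (Complex.exp ((-lam * ρ : ℝ) + (-lam * θ : ℝ) * Complex.I) - 1) / ((lam ^ 2 : ℝ) : ℂ)
        - ((1 + 1 / lam : ℝ) : ℂ) * (ρ + θ * Complex.I)) := by
    rw [normalizedPhase]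
    push_cast
    ring_nf
  rw [real_coefficients, Complex.re_ofReal_mul]
  simp only [Complex.sub_re, Complex.div_ofReal_re, Complex.exp_re, Complex.add_re, Complex.add_im,
    Complex.ofReal_re, Complex.ofReal_im, Complex.re_ofReal_mul, Complex.im_ofReal_mul,
    Complex.I_re, Complex.I_im, Complex.one_re, neg_mul, Real.cos_neg, mul_zero, mul_one, add_zero,
    zero_add]

end NormalizedPhase

section SteepDescent

theorem neg_of_deriv_neg {g g' : ℝ → ℝ} {b : ℝ} (hg : ∀ x, HasDerivAt g (g' x) x) (h0 : g 0 = 0)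
    (hneg : ∀ x ∈ Ioo 0 b, g' x < 0) : ∀ x ∈ Ioc 0 b, g x < 0 := by
  have anti : StrictAntiOn g (Icc 0 b) := by
    refine strictAntiOn_of_deriv_neg (convex_Icc 0 b)
      (fun y _ => (hg y).continuousAt.continuousWithinAt) fun y hy => ?_
    rw [interior_Icc] at hy
    rw [(hg y).deriv]
    exact hneg y hy
  intro x hx
  simpa [h0] using anti ⟨le_rfl, hx.1.le.trans hx.2⟩ ⟨hx.1.le, hx.2⟩ hx.1

theorem hasDerivAt_exp_mul_cos_sin (c s A B x : ℝ) : HasDerivAt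
    (fun x => Real.exp (c * x) * (A * Real.cos (s * x) + B * Real.sin (s * x)))
    (Real.exp (c * x) * ((c * A + s * B) * Real.cos (s * x) +
      (c * B - s * A) * Real.sin (s * x))) x := by
  have linear (k : ℝ) : HasDerivAt (fun x => k * x) k x := hasDerivAt_const_mul k
  exact ((linear c).exp.mul (((linear s).cos.const_mul A).add
    ((linear s).sin.const_mul B))).congr_deriv (by simp only [Pi.add_apply]; ring)

theorem cos_sqrt_three_mul_pos {x : ℝ} (hx : x ∈ Ioo 0 (π / (2 * √3))) : 0 < Real.cos (√3 * x) := by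
  have upper := (lt_div_iff₀ (by positivity)).1 hx.2
  have lower : 0 < √3 * x := mul_pos (by positivity) hx.1
  exact Real.cos_pos_of_mem_Ioo ⟨by linarith [Real.pi_pos], by linarith⟩

/- `exp (c x) cos (√3 x)` has the second order Taylor polynomial `1 + c x - x ^ 2` at the origin and
third derivative `-8 c exp (c x) cos (√3 x)`, so the sign of the remainder is that of `-c`. -/
theorem mul_exp_mul_cos_lt {c : ℝ} (hc : c ^ 2 = 1) {x : ℝ} (hx : x ∈ Ioc 0 (π / (2 * √3))) :
    c * (Real.exp (c * x) * Real.cos (√3 * x)) < c * (1 + c * x - x ^ 2) := by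
  have sqrt_sq : √3 * √3 = 3 := Real.mul_self_sqrt (by norm_num)
  have second : ∀ y ∈ Ioo 0 (π / (2 * √3)), Real.exp (c * y) *
      (-2 * c * Real.cos (√3 * y) + -2 * √3 * Real.sin (√3 * y)) + 2 * c < 0 := by
    refine fun y hy => neg_of_deriv_neg
      (fun z => (hasDerivAt_exp_mul_cos_sin c (√3) _ _ z).add_const _) (by simp) (fun z hz => ?_)
      y ⟨hy.1, hy.2.le⟩
    have := mul_pos (Real.exp_pos (c * z)) (cos_sqrt_three_mul_pos hz)
    linear_combination 8 * this - 2 * Real.exp (c * z) * Real.cos (√3 * z) * hc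
      - 2 * Real.exp (c * z) * Real.cos (√3 * z) * sqrt_sq
  have first : ∀ y ∈ Ioo 0 (π / (2 * √3)), Real.exp (c * y) *
      (1 * Real.cos (√3 * y) + -c * √3 * Real.sin (√3 * y)) + (2 * c * y - 1) < 0 := by
    refine fun y hy => neg_of_deriv_neg
      (fun z => (hasDerivAt_exp_mul_cos_sin c (√3) _ _ z).add
        ((hasDerivAt_const_mul (2 * c)).sub_const 1)) (by simp) (fun z hz => ?_) y ⟨hy.1, hy.2.le⟩
    linear_combination second z hz - Real.exp (c * z) * Real.cos (√3 * z) * c * sqrt_sq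
      - Real.exp (c * z) * Real.sin (√3 * z) * √3 * hc
  have remainder := neg_of_deriv_neg (b := π / (2 * √3))
    (g := fun z => Real.exp (c * z) * (c * Real.cos (√3 * z) + 0 * Real.sin (√3 * z)) +
      (c * z ^ 2 - 1 * z - c))
    (fun z => (hasDerivAt_exp_mul_cos_sin c (√3) _ _ z).add
      ((((hasDerivAt_pow 2 z).const_mul c).sub (hasDerivAt_const_mul 1)).sub_const c)) (by simp)
    (fun z hz => by
      have := first z hz
      norm_num
      linear_combination this + Real.exp (c * z) * Real.cos (√3 * z) * hc) x hx
  linear_combination remainder - x * hc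

theorem exp_mul_cos_lt {x : ℝ} (hx : x ∈ Ioc 0 (π / (2 * √3))) :
    Real.exp x * Real.cos (√3 * x) < 1 + x - x ^ 2 := by
  simpa only [one_mul] using mul_exp_mul_cos_lt (one_pow 2) hx

theorem one_sub_sub_sq_le_exp_neg_mul_cos {x : ℝ} (hx : 0 < x) :
    1 - x - x ^ 2 ≤ Real.exp (-x) * Real.cos (√3 * x) := by
  rcases le_or_gt x (π / (2 * √3)) with near | far
  · have := mul_exp_mul_cos_lt (by norm_num : (-1 : ℝ) ^ 2 = 1) ⟨hx, near⟩
    simp only [neg_mul, one_mul] at this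
    linarith
  · have lower : 0.9 < x := by
      refine lt_of_le_of_lt ?_ far
      have : √3 ≤ 1.74 := (Real.sqrt_le_left (by norm_num)).2 (by norm_num)
      rw [le_div_iff₀ (by positivity)]
      nlinarith [Real.pi_gt_d2]
    have exp_le : Real.exp (-x) ≤ 0.6 := by
      rw [Real.exp_neg, inv_le_comm₀ (Real.exp_pos x) (by norm_num)]
      linarith [Real.add_one_le_exp x, (by norm_num : (0.6 : ℝ)⁻¹ ≤ 1.9)]
    have : -Real.exp (-x) ≤ Real.exp (-x) * Real.cos (√3 * x) := by
      nlinarith [Real.neg_one_le_cos (√3 * x), Real.exp_pos (-x)]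
    nlinarith

theorem re_normalizedPhase_ray_neg {lam : ℝ} (hlam : 0 < lam) {r : ℝ}
    (hr : r ∈ Ioc 0 (π / (2 * √3))) :
    (normalizedPhase lam (r * (1 + √3 * Complex.I))).re < 0 := by
  have cartesian : (r * (1 + √3 * Complex.I) : ℂ) = (r : ℂ) + ((√3 * r : ℝ) : ℂ) * Complex.I := by
    push_cast; ring
  have quadratic_cancel : Real.exp r * Real.cos (√3 * r) - 1 -
      (Real.exp (-(lam * r)) * Real.cos (√3 * (lam * r)) - 1) / lam ^ 2 - (1 + 1 / lam) * r =
      (Real.exp r * Real.cos (√3 * r) - (1 + r - r ^ 2)) -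
      (Real.exp (-(lam * r)) * Real.cos (√3 * (lam * r)) - (1 - lam * r - (lam * r) ^ 2))
        / lam ^ 2 := by
    field_simp
    ring
  rw [cartesian, re_normalizedPhase, mul_left_comm lam, neg_mul, quadratic_cancel]
  refine mul_neg_of_pos_of_neg (by positivity) (sub_neg.2 ?_)
  exact (sub_neg.2 (exp_mul_cos_lt hr)).trans_le (div_nonneg
    (sub_nonneg.2 (one_sub_sub_sq_le_exp_neg_mul_cos (mul_pos hlam hr.1))) (sq_nonneg lam))

theorem exp_neg_sub_exp_neg_le {s t : ℝ} (hs : 0 ≤ s) (hst : s ≤ t) :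
    Real.exp (-s) - Real.exp (-t) ≤ t - s := by
  have factor : Real.exp (-t) = Real.exp (-s) * Real.exp (-(t - s)) := by
    rw [← Real.exp_add]; ring_nf
  have exp_le_one : Real.exp (-s) ≤ 1 := Real.exp_le_one_iff.2 (by linarith)
  calc Real.exp (-s) - Real.exp (-t) = Real.exp (-s) * (1 - Real.exp (-(t - s))) := by
        rw [factor]; ring
    _ ≤ 1 * (t - s) :=
        mul_le_mul exp_le_one (by linarith [Real.add_one_le_exp (-(t - s))])
          (sub_nonneg.2 (Real.exp_le_one_iff.2 (by linarith))) zero_le_one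
    _ = t - s := one_mul _

theorem re_normalizedPhase_horizontal_le {lam : ℝ} (hlam : 0 < lam) {ρ₀ ρ : ℝ} (h0 : 0 ≤ ρ₀)
    (hρ : ρ₀ ≤ ρ) :
    (normalizedPhase lam (ρ + (π / 2 : ℝ) * Complex.I)).re ≤
      (normalizedPhase lam (ρ₀ + (π / 2 : ℝ) * Complex.I)).re - 6 / (1 + lam) * (ρ - ρ₀) := by
  have order : lam * ρ₀ ≤ lam * ρ := mul_le_mul_of_nonneg_left hρ hlam.le
  have oscillation : Real.cos (lam * (π / 2)) *
      (Real.exp (-(lam * ρ₀)) - Real.exp (-(lam * ρ))) ≤ lam * ρ - lam * ρ₀ :=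
    (mul_le_of_le_one_left (sub_nonneg.2 (Real.exp_le_exp.2 (neg_le_neg order)))
      (Real.cos_le_one _)).trans (exp_neg_sub_exp_neg_le (mul_nonneg hlam.le h0) order)
  rw [← sub_nonneg, re_normalizedPhase, re_normalizedPhase, Real.cos_pi_div_two, neg_mul, neg_mul]
  have excess_nonneg : 0 ≤ 6 / (1 + lam) * ((lam * ρ - lam * ρ₀ - Real.cos (lam * (π / 2)) *
      (Real.exp (-(lam * ρ₀)) - Real.exp (-(lam * ρ)))) / lam ^ 2) :=
    mul_nonneg (by positivity) (div_nonneg (sub_nonneg.2 oscillation) (sq_nonneg lam))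
  refine excess_nonneg.trans_eq ?_
  field_simp
  ring

end SteepDescent

section ReciprocalGamma

open ProbabilityTheory
open scoped FourierTransform

theorem integrableOn_rpow_mul_exp_neg_mul {s r : ℝ} (hs : 0 < s) (hr : 0 < r) :
    IntegrableOn (fun t : ℝ => t ^ (s - 1) * Real.exp (-r * t)) (Ioi 0) := by
  simpa using integrableOn_rpow_mul_exp_neg_mul_rpow (by linarith : -1 < s - 1) one_pos hr

/-- The measure `t ^ (s - 1) dt` on the positive half line, whose moment generating function at `-r`
is the Laplace transform of `t ^ (s - 1)` at `r`. -/
noncomputable def rpowMeasure (s : ℝ) : Measure ℝ :=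
  (volume.restrict (Ioi 0)).withDensity fun t => ENNReal.ofReal (t ^ (s - 1))

theorem integral_rpowMeasure (s : ℝ) (f : ℝ → ℂ) :
    ∫ t, f t ∂rpowMeasure s = ∫ t in Ioi (0 : ℝ), ((t ^ (s - 1) : ℝ) : ℂ) * f t := by
  rw [rpowMeasure, integral_withDensity_eq_integral_toReal_smul (by fun_prop) (by simp)]
  refine setIntegral_congr_fun measurableSet_Ioi fun t ht => ?_
  rw [ENNReal.toReal_ofReal (Real.rpow_nonneg (le_of_lt ht) _), Complex.real_smul]

theorem Iio_subset_integrableExpSet_rpowMeasure {s : ℝ} (hs : 0 < s) :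
    Iio 0 ⊆ integrableExpSet id (rpowMeasure s) := fun r (hr : r < 0) => by
  rw [integrableExpSet, mem_ofPred_eq, rpowMeasure,
    integrable_withDensity_iff_integrable_smul' (by fun_prop) (by simp)]
  refine (integrableOn_rpow_mul_exp_neg_mul hs (neg_pos.2 hr)).congr_fun (fun t ht => ?_)
    measurableSet_Ioi
  simp only [ENNReal.toReal_ofReal (Real.rpow_nonneg (le_of_lt ht) _), neg_neg, id, smul_eq_mul]

theorem integral_rpow_mul_cexp_neg_mul_Ioi {s : ℝ} (hs : 0 < s) {r : ℂ} (hr : 0 < r.re) :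
    ∫ t in Ioi (0 : ℝ), ((t ^ (s - 1) : ℝ) : ℂ) * Complex.exp (-r * t) =
      Real.Gamma s * r ^ (-(s : ℂ)) := by
  have analytic_left : AnalyticOnNhd ℂ (fun z => complexMGF id (rpowMeasure s) (-z))
      {z | 0 < z.re} := fun z (hz : 0 < z.re) =>
    (analyticAt_complexMGF (interior_mono (Iio_subset_integrableExpSet_rpowMeasure hs)
      (by simpa using hz))).comp analyticAt_id.neg
  have analytic_right : AnalyticOnNhd ℂ (fun z : ℂ => Real.Gamma s * z ^ (-(s : ℂ)))
      {z | 0 < z.re} := fun z hz =>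
    analyticAt_const.mul (analyticAt_id.cpow analyticAt_const (Or.inl hz))
  have eq_of_pos (y : ℝ) (hy : 0 < y) :
      complexMGF id (rpowMeasure s) (-(y : ℂ)) = Real.Gamma s * (y : ℂ) ^ (-(s : ℂ)) := by
    have h := Real.integral_rpow_mul_exp_neg_mul_Ioi hs hy
    rw [complexMGF, integral_rpowMeasure, ← Complex.ofReal_neg, ← Complex.ofReal_neg,
      ← Complex.ofReal_cpow hy.le, Real.rpow_neg hy.le, ← Real.inv_rpow hy.le, ← one_div,
      mul_comm, ← Complex.ofReal_mul, ← h, ← integral_complex_ofReal]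
    simp [neg_mul]
  have frequently_eq : ∃ᶠ z : ℂ in 𝓝[≠] 1, complexMGF id (rpowMeasure s) (-z) =
      Real.Gamma s * z ^ (-(s : ℂ)) := by
    have h : Tendsto ((↑) : ℝ → ℂ) (𝓝[≠] 1) (𝓝[≠] 1) :=
      tendsto_nhdsWithin_of_tendsto_nhds_of_eventually_within _
        ((Complex.continuous_ofReal.tendsto' 1 1 (by simp)).mono_left nhdsWithin_le_nhds)
        (eventually_mem_nhdsWithin.mono fun y hy => by simpa using hy)
    refine h.frequently (Eventually.frequently ?_)
    filter_upwards [mem_nhdsWithin_of_mem_nhds (Ioi_mem_nhds one_pos)] with y hy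
    exact eq_of_pos y hy
  have h := analytic_left.eqOn_of_preconnected_of_frequently_eq analytic_right
    (convex_halfSpace_re_gt 0).isPreconnected (by simp) frequently_eq hr
  simpa [complexMGF, integral_rpowMeasure] using h

theorem one_add_mul_I_mem_slitPlane (y : ℝ) : 1 + (y : ℂ) * Complex.I ∈ Complex.slitPlane :=
  Or.inl (by simp)

theorem one_add_mul_I_ne_zero (y : ℝ) : 1 + (y : ℂ) * Complex.I ≠ 0 :=
  Complex.slitPlane_ne_zero (one_add_mul_I_mem_slitPlane y)

theorem continuous_one_add_mul_I_cpow (s : ℂ) :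
    Continuous fun y : ℝ => (1 + (y : ℂ) * Complex.I) ^ s :=
  Continuous.cpow (by fun_prop) continuous_const one_add_mul_I_mem_slitPlane

theorem norm_one_add_mul_I_cpow (s y : ℝ) :
    ‖(1 + (y : ℂ) * Complex.I) ^ (-(s : ℂ))‖ = (1 + ‖y‖ ^ 2) ^ (-s / 2) := by
  have norm_base : ‖1 + (y : ℂ) * Complex.I‖ = √(1 + ‖y‖ ^ 2) := by
    simpa using Complex.norm_add_mul_I 1 y
  rw [← Complex.ofReal_neg, Complex.norm_cpow_real, norm_base, Real.sqrt_eq_rpow,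
    ← Real.rpow_mul (by positivity)]
  congr 1
  ring

theorem integrable_one_add_mul_I_cpow {s : ℝ} (hs : 1 < s) :
    Integrable fun y : ℝ => (1 + (y : ℂ) * Complex.I) ^ (-(s : ℂ)) := by
  refine Integrable.mono' (integrable_rpow_neg_one_add_norm_sq (E := ℝ) (r := s)
    (by simpa using hs)) (continuous_one_add_mul_I_cpow _).aestronglyMeasurable
    (Eventually.of_forall fun y => ?_)
  rw [norm_one_add_mul_I_cpow]

/-- The unnormalised Gamma density `t ^ (s - 1) e ^ (-t)` on the positive half line, extended
by zero and regarded as complex valued so that its Fourier transform makes sense. -/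
noncomputable def gammaKernel (s : ℝ) : ℝ → ℂ :=
  indicator (Ioi 0) fun t => ((t ^ (s - 1) * Real.exp (-t) : ℝ) : ℂ)

theorem integrable_gammaKernel {s : ℝ} (hs : 0 < s) : Integrable (gammaKernel s) := by
  rw [gammaKernel, integrable_indicator_iff measurableSet_Ioi]
  simpa using! (integrableOn_rpow_mul_exp_neg_mul hs one_pos).ofReal (𝕜 := ℂ)

theorem continuous_gammaKernel {s : ℝ} (hs : 1 < s) : Continuous (gammaKernel s) := by
  have eq_max : gammaKernel s = fun t => ((max t 0 ^ (s - 1) * Real.exp (-t) : ℝ) : ℂ) := by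
    funext t
    by_cases ht : t ∈ Ioi (0 : ℝ)
    · rw [gammaKernel, indicator_of_mem ht, max_eq_left (le_of_lt ht)]
    · rw [gammaKernel, indicator_of_notMem ht, max_eq_right (not_lt.1 ht),
        Real.zero_rpow (by linarith), zero_mul, Complex.ofReal_zero]
  have continuous_rpow : Continuous fun t : ℝ => max t 0 ^ (s - 1) :=
    (continuous_id.max continuous_const).rpow_const fun _ => Or.inr (by linarith)
  rw [eq_max]
  fun_prop

theorem fourier_gammaKernel {s : ℝ} (hs : 0 < s) (w : ℝ) : 𝓕 (gammaKernel s) w =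
    Real.Gamma s * (1 + ((2 * π * w : ℝ) : ℂ) * Complex.I) ^ (-(s : ℂ)) := by
  rw [← integral_rpow_mul_cexp_neg_mul_Ioi hs (by simp), Real.fourier_real_eq_integral_exp_smul,
    ← integral_indicator measurableSet_Ioi]
  congr 1
  funext t
  by_cases ht : t ∈ Ioi (0 : ℝ)
  · rw [gammaKernel, indicator_of_mem ht, indicator_of_mem ht, smul_eq_mul,
      Complex.ofReal_mul (t ^ (s - 1)), mul_left_comm, Complex.ofReal_exp, ← Complex.exp_add]
    congr 2
    push_cast
    ring
  · rw [gammaKernel, indicator_of_notMem ht, indicator_of_notMem ht, smul_zero]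

theorem gammaKernel_one_eq_integral {s : ℝ} (hs : 1 < s) : (2 * π : ℂ) * gammaKernel s 1 =
    Real.Gamma s * ∫ y : ℝ, Complex.exp (y * Complex.I) * (1 + y * Complex.I) ^ (-(s : ℂ)) := by
  have hs0 : 0 < s := one_pos.trans hs
  have integrable_fourier : Integrable (𝓕 (gammaKernel s)) := by
    rw [funext (fourier_gammaKernel hs0)]
    exact ((integrable_one_add_mul_I_cpow hs).comp_mul_left' (by positivity)).const_mul _
  have inversion := congrFun ((continuous_gammaKernel hs).fourierInv_fourier_eq
    (integrable_gammaKernel hs0) integrable_fourier) 1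
  set g : ℝ → ℂ := fun y => Complex.exp (y * Complex.I) * (1 + y * Complex.I) ^ (-(s : ℂ)) with hg
  have integrand_eq (w : ℝ) :
      Complex.exp (((2 * π * inner ℝ w (1 : ℝ) : ℝ) : ℂ) * Complex.I) • 𝓕 (gammaKernel s) w =
        Real.Gamma s * g (2 * π * w) := by
    rw [fourier_gammaKernel hs0, smul_eq_mul, mul_left_comm, hg]
    simp
  rw [Real.fourierInv_eq'] at inversion
  simp_rw [integrand_eq] at inversion
  rw [integral_const_mul, Measure.integral_comp_mul_left, abs_of_pos (by positivity),
    Complex.real_smul] at inversion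
  rw [← inversion]
  push_cast
  field_simp

theorem integral_cexp_mul_cpow_neg {s : ℝ} (hs : 1 < s) :
    ∫ y : ℝ, Complex.exp (1 + y * Complex.I) * (1 + y * Complex.I) ^ (-(s : ℂ)) =
      2 * π / Real.Gamma s := by
  have gamma_ne_zero : (Real.Gamma s : ℂ) ≠ 0 :=
    Complex.ofReal_ne_zero.2 (Real.Gamma_pos_of_pos (one_pos.trans hs)).ne'
  have kernel_one : gammaKernel s 1 = Complex.exp (-1) := by simp [gammaKernel]
  have h := gammaKernel_one_eq_integral hs
  simp_rw [Complex.exp_add, mul_assoc]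
  rw [integral_const_mul, eq_div_iff gamma_ne_zero, mul_assoc, mul_comm _ (Real.Gamma s : ℂ), ← h,
    kernel_one, mul_left_comm, ← Complex.exp_add]
  simp

end ReciprocalGamma

section LaplaceRepresentation

theorem one_le_norm_one_add_mul_I (y : ℝ) : 1 ≤ ‖1 + (y : ℂ) * Complex.I‖ := by
  simpa using Complex.abs_re_le_norm (1 + (y : ℂ) * Complex.I)

theorem norm_one_add_mul_I_cpow_neg_le {c : ℝ} (hc : 0 ≤ c) (y : ℝ) :
    ‖(1 + (y : ℂ) * Complex.I) ^ (-(c : ℂ))‖ ≤ 1 := by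
  rw [← Complex.ofReal_neg, Complex.norm_cpow_real]
  exact Real.rpow_le_one_of_one_le_of_nonpos (one_le_norm_one_add_mul_I y) (by linarith)

theorem norm_cexp_one_add_mul_I (y : ℝ) :
    ‖Complex.exp (1 + (y : ℂ) * Complex.I)‖ = Real.exp 1 := by
  simp [Complex.norm_exp]

variable {lam mu : ℝ}

/-- The `n`-th term of the integrand obtained by inserting Laplace's integral for `1 / Γ` into the
Wright series, on the line `1 + i y`. -/
noncomputable def wrightTerm (lam mu z : ℝ) (n : ℕ) (y : ℝ) : ℂ :=
  ((z ^ n / n.factorial : ℝ) : ℂ) * (Complex.exp (1 + y * Complex.I) *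
    (1 + y * Complex.I) ^ (-((lam * n + mu : ℝ) : ℂ)))

theorem wrightTerm_eq (lam mu z : ℝ) (n : ℕ) (y : ℝ) : wrightTerm lam mu z n y =
    Complex.exp (1 + y * Complex.I) * (1 + y * Complex.I) ^ (-(mu : ℂ)) *
      ((z * (1 + y * Complex.I) ^ (-(lam : ℂ))) ^ n / n.factorial) := by
  have cpow_eq : (1 + (y : ℂ) * Complex.I) ^ (-((lam * n + mu : ℝ) : ℂ)) =
      ((1 + (y : ℂ) * Complex.I) ^ (-(lam : ℂ))) ^ n * (1 + (y : ℂ) * Complex.I) ^ (-(mu : ℂ)) := by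
    rw [← Complex.cpow_mul_nat, ← Complex.cpow_add _ _ (one_add_mul_I_ne_zero y)]
    congr 1
    push_cast
    ring
  rw [wrightTerm, cpow_eq, mul_pow]
  push_cast
  ring

theorem hasSum_wrightTerm (lam mu z y : ℝ) : HasSum (fun n => wrightTerm lam mu z n y)
    (Complex.exp (1 + y * Complex.I) * (1 + y * Complex.I) ^ (-(mu : ℂ)) *
      Complex.exp (z * (1 + y * Complex.I) ^ (-(lam : ℂ)))) := by
  have hasSum_exp := NormedSpace.expSeries_div_hasSum_exp
    ((z : ℂ) * (1 + y * Complex.I) ^ (-(lam : ℂ)))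
  rw [← Complex.exp_eq_exp_ℂ] at hasSum_exp
  simp_rw [wrightTerm_eq]
  exact hasSum_exp.mul_left _

theorem norm_wrightTerm_le (hlam : 0 ≤ lam) (mu z : ℝ) (n : ℕ) (y : ℝ) :
    ‖wrightTerm lam mu z n y‖ ≤
      |z| ^ n / n.factorial * (Real.exp 1 * ‖(1 + y * Complex.I) ^ (-(mu : ℂ))‖) := by
  rw [wrightTerm_eq, norm_mul, norm_mul, norm_cexp_one_add_mul_I, mul_comm, norm_div, norm_pow,
    norm_mul, Complex.norm_real, Real.norm_eq_abs, Complex.norm_natCast]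
  gcongr
  exact mul_le_of_le_one_right (abs_nonneg z) (norm_one_add_mul_I_cpow_neg_le hlam y)

theorem integrable_wrightTerm_bound (hmu : 1 < mu) (c : ℝ) : Integrable fun y : ℝ =>
    c * (Real.exp 1 * ‖(1 + y * Complex.I) ^ (-(mu : ℂ))‖) :=
  ((integrable_one_add_mul_I_cpow hmu).norm.const_mul _).const_mul c

theorem integrable_wrightTerm (hlam : 0 ≤ lam) (hmu : 1 < mu) (z : ℝ) (n : ℕ) :
    Integrable (wrightTerm lam mu z n) := by
  have continuous_cpow := continuous_one_add_mul_I_cpow (-((lam * n + mu : ℝ) : ℂ))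
  refine (integrable_wrightTerm_bound hmu _).mono' (Continuous.aestronglyMeasurable ?_)
    (Eventually.of_forall (norm_wrightTerm_le hlam mu z n))
  unfold wrightTerm
  fun_prop

theorem integral_wrightTerm (hlam : 0 ≤ lam) (hmu : 1 < mu) (z : ℝ) (n : ℕ) :
    ∫ y, wrightTerm lam mu z n y =
      ((2 * π * (z ^ n / (n.factorial * Real.Gamma (lam * n + mu))) : ℝ) : ℂ) := by
  have one_lt : 1 < lam * n + mu := by nlinarith [n.cast_nonneg (α := ℝ)]
  unfold wrightTerm
  rw [integral_const_mul, integral_cexp_mul_cpow_neg one_lt]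
  push_cast
  rw [div_mul_div_comm, mul_comm, mul_div_assoc]

theorem integrable_wright_integrand (hlam : 0 ≤ lam) (hmu : 1 < mu) (z : ℝ) :
    Integrable fun y : ℝ => Complex.exp (1 + y * Complex.I) * (1 + y * Complex.I) ^ (-(mu : ℂ)) *
      Complex.exp (z * (1 + y * Complex.I) ^ (-(lam : ℂ))) := by
  have continuous_mu := continuous_one_add_mul_I_cpow (-(mu : ℂ))
  have continuous_lam := continuous_one_add_mul_I_cpow (-(lam : ℂ))
  refine (integrable_wrightTerm_bound hmu (Real.exp |z|)).mono'
    (Continuous.aestronglyMeasurable (by fun_prop)) (Eventually.of_forall fun y => ?_)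
  rw [norm_mul, norm_mul, norm_cexp_one_add_mul_I, mul_comm]
  gcongr
  refine (Complex.norm_exp_le_exp_norm _).trans (Real.exp_le_exp.2 ?_)
  rw [norm_mul, Complex.norm_real, Real.norm_eq_abs]
  exact mul_le_of_le_one_right (abs_nonneg z) (norm_one_add_mul_I_cpow_neg_le hlam y)

theorem two_pi_mul_wright (hlam : 0 ≤ lam) (hmu : 1 < mu) (z : ℝ) :
    2 * π * (wright lam mu z : ℂ) = ∫ y : ℝ,
      Complex.exp (1 + y * Complex.I) * (1 + y * Complex.I) ^ (-(mu : ℂ)) *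
        Complex.exp (z * (1 + y * Complex.I) ^ (-(lam : ℂ))) := by
  have summable_norm : Summable fun n => ∫ y, ‖wrightTerm lam mu z n y‖ := by
    refine Summable.of_nonneg_of_le (fun n => integral_nonneg fun y => norm_nonneg _)
      (fun n => integral_mono (integrable_wrightTerm hlam hmu z n).norm
        (integrable_wrightTerm_bound hmu _) (norm_wrightTerm_le hlam mu z n)) ?_
    simp_rw [integral_const_mul]
    exact (Real.summable_pow_div_factorial |z|).mul_right _
  have h := hasSum_integral_of_summable_integral_norm (integrable_wrightTerm hlam hmu z)
    summable_norm
  simp_rw [integral_wrightTerm hlam hmu, (hasSum_wrightTerm lam mu z _).tsum_eq] at h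
  rw [← h.tsum_eq, ← Complex.ofReal_tsum, tsum_mul_left, wright]
  push_cast
  rfl

/-- The path `log ((1 + i y) / (x / 2))`, with the principal logarithm: the image of the line
`Re z = 1` under the substitution that turns Laplace's integrand into `e ^ (x h(u))`. -/
noncomputable def logLine (x y : ℝ) : ℂ :=
  Complex.log (1 + y * Complex.I) - (Real.log (x / 2) : ℝ)

theorem cexp_mul_logLine {x : ℝ} (hx : 0 < x) (c y : ℝ) : Complex.exp ((c : ℂ) * logLine x y) =
    (1 + y * Complex.I) ^ (c : ℂ) * (((x / 2) ^ (-c) : ℝ) : ℂ) := by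
  rw [logLine, Complex.cpow_def_of_ne_zero (one_add_mul_I_ne_zero y),
    Real.rpow_def_of_pos (by positivity), Complex.ofReal_exp, ← Complex.exp_add]
  congr 1
  push_cast
  ring

theorem mul_phase_logLine {x : ℝ} (hx : 0 < x) (a lam y : ℝ) :
    (x : ℂ) * phase lam a (logLine x y) = (1 + y * Complex.I) +
      ((-(x / 2) ^ (lam + 1) : ℝ) : ℂ) * (1 + y * Complex.I) ^ (-(lam : ℂ)) +
        ((-(a * x) : ℝ) : ℂ) * logLine x y := by
  have exp_logLine : Complex.exp (logLine x y) = (1 + y * Complex.I) / ((x / 2 : ℝ) : ℂ) := by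
    simpa [Real.rpow_neg_one, div_eq_mul_inv] using cexp_mul_logLine hx 1 y
  have exp_neg_lam := cexp_mul_logLine hx (-lam) y
  rw [neg_neg, Complex.ofReal_neg] at exp_neg_lam
  rw [phase, exp_logLine, exp_neg_lam, Real.rpow_add_one (by positivity)]
  have : (x : ℂ) ≠ 0 := Complex.ofReal_ne_zero.2 hx.ne'
  push_cast
  field_simp
  ring

theorem cexp_phase_logLine {x : ℝ} (hx : 0 < x) (a lam y : ℝ) :
    Complex.exp (x * phase lam a (logLine x y)) / (1 + y * Complex.I) =
      (((x / 2) ^ (a * x) : ℝ) : ℂ) * (Complex.exp (1 + y * Complex.I) *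
        (1 + y * Complex.I) ^ (-((a * x + 1 : ℝ) : ℂ)) *
        Complex.exp (((-(x / 2) ^ (lam + 1) : ℝ) : ℂ) * (1 + y * Complex.I) ^ (-(lam : ℂ)))) := by
  have cpow_eq : (1 + y * Complex.I) ^ (-((a * x + 1 : ℝ) : ℂ)) =
      (1 + y * Complex.I) ^ ((-(a * x) : ℝ) : ℂ) / (1 + y * Complex.I) := by
    rw [Complex.ofReal_add, neg_add, Complex.cpow_add _ _ (one_add_mul_I_ne_zero y),
      Complex.ofReal_one, Complex.cpow_neg_one, div_eq_mul_inv, Complex.ofReal_neg]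
  rw [mul_phase_logLine hx, Complex.exp_add, Complex.exp_add, cexp_mul_logLine hx, neg_neg, cpow_eq]
  ring

variable {a x : ℝ}

theorem integrable_cexp_phase_logLine (hlam : 0 ≤ lam) (ha : 0 < a) (hx : 0 < x) :
    Integrable fun y : ℝ =>
      Complex.exp (x * phase lam a (logLine x y)) / (1 + y * Complex.I) := by
  simp_rw [cexp_phase_logLine hx]
  exact (integrable_wright_integrand hlam (by simpa using mul_pos ha hx) _).const_mul _

theorem two_pi_mul_wrightMinus (hlam : 0 ≤ lam) (ha : 0 < a) (hx : 0 < x) :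
    2 * π * (wrightMinus lam (a * x) x : ℂ) = ∫ y : ℝ,
      Complex.exp (x * phase lam a (logLine x y)) / (1 + y * Complex.I) := by
  simp_rw [cexp_phase_logLine hx]
  rw [integral_const_mul, ← two_pi_mul_wright hlam (by simpa using mul_pos ha hx), wrightMinus]
  push_cast
  ring

end LaplaceRepresentation

section ContourDeformation

theorem exists_primitive_conj {f : ℂ → ℂ} (hf : Differentiable ℂ f)
    (hconj : ∀ u, f (conj u) = conj (f u)) (c : ℝ) :
    ∃ P : ℂ → ℂ, P c = 0 ∧ (∀ u, HasDerivAt P (f u) u) ∧ ∀ u, P (conj u) = conj (P u) := by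
  obtain ⟨P, hPc, hP⟩ := hf.isExactOn_univ.with_val_at (c : ℂ) 0
  replace hP (u : ℂ) : HasDerivAt P (f u) u := hP u (mem_univ u)
  have hasDerivAt_conj (u : ℂ) : HasDerivAt (conj ∘ P ∘ conj) (f u) u := by
    simpa [hconj] using (hP (conj u)).conj_conj
  have hasDerivAt_sub (u : ℂ) : HasDerivAt (conj ∘ P ∘ conj - P) 0 u := by
    simpa using (hasDerivAt_conj u).sub (hP u)
  refine ⟨P, hPc, hP, fun u => ?_⟩
  have h := is_const_of_deriv_eq_zero (fun u => (hasDerivAt_sub u).differentiableAt)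
    (fun u => (hasDerivAt_sub u).deriv) u c
  simp only [Pi.sub_apply, Function.comp_apply, Complex.conj_ofReal, hPc, map_zero, sub_self] at h
  simpa using congrArg conj (sub_eq_zero.1 h)

theorem hasDerivAt_vertical {P f : ℂ → ℂ} (hP : ∀ u, HasDerivAt P (f u) u) (ρ θ : ℝ) :
    HasDerivAt (fun θ : ℝ => P (ρ + θ * Complex.I)) (f (ρ + θ * Complex.I) * Complex.I) θ := by
  have h : HasDerivAt (fun θ : ℝ => (ρ : ℂ) + θ * Complex.I) Complex.I θ := by
    simpa using ((hasDerivAt_id θ).ofReal_comp.mul_const Complex.I).const_add (ρ : ℂ)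
  exact (hP _).comp θ h

theorem re_phase (lam a ρ θ : ℝ) : (phase lam a (ρ + θ * Complex.I)).re =
    (Real.exp ρ * Real.cos θ - Real.exp (-lam * ρ) * Real.cos (lam * θ)) / 2 - a * ρ := by
  have h : phase lam a (ρ + θ * Complex.I) = (Complex.exp (ρ + θ * Complex.I) -
      Complex.exp ((-lam * ρ : ℝ) + (-lam * θ : ℝ) * Complex.I)) / ((2 : ℝ) : ℂ) -
      (a : ℂ) * (ρ + θ * Complex.I) := by
    unfold phase
    push_cast
    congr 4
    ring_nf
  rw [h]
  simp [Complex.exp_re]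

theorem re_phase_le_of_le_re {lam : ℝ} (hlam : 0 ≤ lam) (a : ℝ) {ρ θ θ₀ : ℝ} (hρ : 0 ≤ ρ)
    (h0 : 0 ≤ θ₀) (hθ : θ ∈ Icc θ₀ (π / 2)) : (phase lam a (ρ + θ * Complex.I)).re ≤
      (Real.exp ρ * Real.cos θ₀ + 1) / 2 - a * ρ := by
  have cos_le : Real.cos θ ≤ Real.cos θ₀ :=
    Real.cos_le_cos_of_nonneg_of_le_pi h0 (by linarith [hθ.2, Real.pi_pos]) hθ.1
  have exp_le : Real.exp (-lam * ρ) ≤ 1 := Real.exp_le_one_iff.2 (by nlinarith)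
  have neg_one_le : -1 ≤ Real.exp (-lam * ρ) * Real.cos (lam * θ) := by
    nlinarith [Real.exp_pos (-lam * ρ), Real.neg_one_le_cos (lam * θ)]
  rw [re_phase]
  linarith [mul_le_mul_of_nonneg_left cos_le (Real.exp_pos ρ).le]

theorem logLine_im (x y : ℝ) : (logLine x y).im = Complex.arg (1 + y * Complex.I) := by
  rw [logLine, Complex.sub_im, Complex.ofReal_im, Complex.log_im, sub_zero]

theorem logLine_im_mem {y : ℝ} (hy : 0 ≤ y) (x : ℝ) : (logLine x y).im ∈ Icc 0 (π / 2) := by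
  rw [logLine_im]
  exact ⟨Complex.arg_nonneg_iff.2 (by simpa using hy),
    (abs_le.1 (Complex.abs_arg_le_pi_div_two_iff.2 (by simp))).2⟩

theorem logLine_neg (x y : ℝ) : logLine x (-y) = conj (logLine x y) := by
  rw [logLine, logLine, map_sub, Complex.conj_ofReal, ← Complex.log_conj]
  · simp
  · exact (Complex.mem_slitPlane_iff_arg.1 (one_add_mul_I_mem_slitPlane y)).1

theorem hasDerivAt_logLine (x y : ℝ) :
    HasDerivAt (logLine x) (Complex.I / (1 + y * Complex.I)) y := by
  have h : HasDerivAt (fun y : ℝ => 1 + (y : ℂ) * Complex.I) Complex.I y := by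
    simpa using ((hasDerivAt_id y).ofReal_comp.mul_const Complex.I).const_add 1
  exact (h.clog_real (one_add_mul_I_mem_slitPlane y)).sub_const _

variable {lam a x : ℝ}

theorem exp_re_logLine (hx : 0 < x) (y : ℝ) :
    Real.exp (logLine x y).re = ‖1 + y * Complex.I‖ / (x / 2) := by
  rw [logLine, Complex.sub_re, Complex.ofReal_re, Complex.log_re, Real.exp_sub, Real.exp_log
    (norm_pos_iff.2 (one_add_mul_I_ne_zero y)), Real.exp_log (by positivity)]

theorem exp_re_mul_cos_im_logLine (hx : 0 < x) (y : ℝ) :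
    Real.exp (logLine x y).re * Real.cos (logLine x y).im = 2 / x := by
  have norm_ne_zero : ‖1 + y * Complex.I‖ ≠ 0 := norm_ne_zero_iff.2 (one_add_mul_I_ne_zero y)
  rw [exp_re_logLine hx, logLine_im, Complex.cos_arg (one_add_mul_I_ne_zero y)]
  simp only [Complex.add_re, Complex.one_re, Complex.re_ofReal_mul, Complex.I_re, mul_zero,
    add_zero]
  field_simp

theorem tendsto_re_logLine (hx : 0 < x) : Tendsto (fun y => (logLine x y).re) atTop atTop := by
  have tendsto_exp : Tendsto (fun y : ℝ => Real.exp (logLine x y).re) atTop atTop := by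
    simp_rw [exp_re_logLine hx]
    refine Tendsto.atTop_div_const (by positivity) (tendsto_atTop_mono (fun y => ?_) tendsto_id)
    exact (le_abs_self y).trans (by simpa using Complex.abs_im_le_norm (1 + (y : ℂ) * Complex.I))
  simpa [Function.comp_def] using Real.tendsto_log_atTop.comp tendsto_exp

variable {P : ℂ → ℂ} {L : ℂ}

theorem norm_primitive_logLine_sub_le (hlam : 0 ≤ lam) (hx : 0 < x)
    (hP : ∀ u, HasDerivAt P (Complex.exp (x * phase lam a u)) u) {y : ℝ} (hy : 0 ≤ y)
    (hρ : 0 ≤ (logLine x y).re) :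
    ‖P (logLine x y) - P ((logLine x y).re + (π / 2 : ℝ) * Complex.I)‖ ≤
      Real.exp (1 + x / 2 + -(a * x) * (logLine x y).re) * (π / 2) := by
  obtain ⟨im_nonneg, im_le⟩ := logLine_im_mem hy x
  have norm_deriv_le (θ : ℝ) (hθ : θ ∈ Icc (logLine x y).im (π / 2)) :
      ‖Complex.exp (x * phase lam a ((logLine x y).re + θ * Complex.I)) * Complex.I‖ ≤
        Real.exp (1 + x / 2 + -(a * x) * (logLine x y).re) := by
    have h := mul_le_mul_of_nonneg_left (re_phase_le_of_le_re hlam a hρ im_nonneg hθ) hx.le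
    rw [norm_mul, Complex.norm_I, mul_one, Complex.norm_exp, Complex.re_ofReal_mul]
    refine Real.exp_le_exp.2 (h.trans_eq ?_)
    rw [exp_re_mul_cos_im_logLine hx]
    field_simp
    ring
  have h := (convex_Icc (logLine x y).im (π / 2)).norm_image_sub_le_of_norm_hasDerivWithin_le
    (fun θ _ => (hasDerivAt_vertical hP (logLine x y).re θ).hasDerivWithinAt) norm_deriv_le
    (right_mem_Icc.2 im_le) (left_mem_Icc.2 im_le)
  rw [Complex.re_add_im] at h
  refine h.trans (mul_le_mul_of_nonneg_left ?_ (Real.exp_pos _).le)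
  rw [Real.norm_eq_abs, abs_le]
  constructor <;> linarith

-- Along `logLine` the growing part `e ^ ρ cos θ` of the phase is constant: `e ^ (-a x ρ)` wins.
theorem tendsto_primitive_logLine (hlam : 0 ≤ lam) (ha : 0 < a) (hx : 0 < x)
    (hP : ∀ u, HasDerivAt P (Complex.exp (x * phase lam a u)) u)
    (hL : Tendsto (fun ρ : ℝ => P (ρ + (π / 2 : ℝ) * Complex.I)) atTop (𝓝 L)) :
    Tendsto (fun y => P (logLine x y)) atTop (𝓝 L) := by
  have bound_tendsto : Tendsto (fun y : ℝ => Real.exp (1 + x / 2 + -(a * x) * (logLine x y).re) *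
      (π / 2)) atTop (𝓝 0) := by
    rw [← zero_mul (π / 2)]
    refine Tendsto.mul_const _ (Real.tendsto_exp_atBot.comp (tendsto_atBot_add_const_left _ _ ?_))
    exact (tendsto_re_logLine hx).const_mul_atTop_of_neg (neg_lt_zero.2 (mul_pos ha hx))
  have sub_tendsto : Tendsto (fun y : ℝ => P (logLine x y) -
      P ((logLine x y).re + (π / 2 : ℝ) * Complex.I)) atTop (𝓝 0) := by
    refine squeeze_zero_norm' ?_ bound_tendsto
    filter_upwards [eventually_ge_atTop 0, (tendsto_re_logLine hx).eventually_ge_atTop 0]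
      with y hy hρ using norm_primitive_logLine_sub_le hlam hx hP hy hρ
  simpa using sub_tendsto.add (hL.comp (tendsto_re_logLine hx))

-- The lower half of the contour is conjugate to the upper half: the integral is `L - conj L`.
theorem pi_mul_wrightMinus (hlam : 0 ≤ lam) (ha : 0 < a) (hx : 0 < x)
    (hP : ∀ u, HasDerivAt P (Complex.exp (x * phase lam a u)) u)
    (hconj : ∀ u, P (conj u) = conj (P u))
    (hL : Tendsto (fun ρ : ℝ => P (ρ + (π / 2 : ℝ) * Complex.I)) atTop (𝓝 L)) :
    π * wrightMinus lam (a * x) x = L.im := by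
  have tendsto_top := tendsto_primitive_logLine hlam ha hx hP hL
  have tendsto_bot : Tendsto (fun y => P (logLine x y)) atBot (𝓝 (conj L)) := by
    refine ((Complex.continuous_conj.tendsto L).comp
      (tendsto_top.comp tendsto_neg_atBot_atTop)).congr fun y => ?_
    simp only [Function.comp_apply, ← hconj, ← logLine_neg, neg_neg]
  have hasDerivAt_path (y : ℝ) : HasDerivAt (fun y => P (logLine x y))
      (Complex.I * (Complex.exp (x * phase lam a (logLine x y)) / (1 + y * Complex.I))) y :=
    ((hP _).comp y (hasDerivAt_logLine x y)).congr_deriv (by ring)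
  have h := integral_of_hasDerivAt_of_tendsto hasDerivAt_path
    ((integrable_cexp_phase_logLine hlam ha hx).const_mul Complex.I) tendsto_bot tendsto_top
  rw [integral_const_mul, ← two_pi_mul_wrightMinus hlam ha hx, Complex.sub_conj] at h
  push_cast at h
  have two_I_mul_eq : (2 * Complex.I) * ((π * wrightMinus lam (a * x) x : ℝ) : ℂ) =
      (2 * Complex.I) * (L.im : ℂ) := by
    push_cast
    linear_combination h
  exact Complex.ofReal_injective (mul_left_cancel₀ (by simp) two_I_mul_eq)

end ContourDeformation

section LocalInverse

theorem tendsto_conj_zero : Tendsto (conj : ℂ → ℂ) (𝓝 0) (𝓝 0) :=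
  Complex.continuous_conj.tendsto' 0 0 (map_zero _)

theorem exists_eventually_eq_pow_mul {F : ℂ → ℂ} (hF : AnalyticAt ℂ F 0) {m : ℕ}
    (hlt : ∀ i < m, iteratedDeriv i F 0 = 0) (hm : iteratedDeriv m F 0 = m.factorial) :
    ∃ G : ℂ → ℂ, AnalyticAt ℂ G 0 ∧ G 0 = 1 ∧ ∀ᶠ t in 𝓝 0, F t = t ^ m * G t := by
  have le_order : ((m + 1 : ℕ) : ℕ∞) ≤ analyticOrderAt (fun t => F t - t ^ m) 0 := by
    rw [natCast_le_analyticOrderAt_iff_iteratedDeriv_eq_zero (by fun_prop)]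
    intro i hi
    rw [iteratedDeriv_fun_sub hF.contDiffAt (by fun_prop), iteratedDeriv_fun_pow_zero]
    rcases Nat.lt_succ_iff_lt_or_eq.1 hi with hi | rfl
    · simp [hlt i hi, hi.ne]
    · simp [hm]
  obtain ⟨g, hg, hFg⟩ := (natCast_le_analyticOrderAt (by fun_prop)).1 le_order
  refine ⟨fun t => 1 + t * g t, by fun_prop, by simp, hFg.mono fun t ht => ?_⟩
  rw [sub_zero, smul_eq_mul] at ht
  linear_combination ht

theorem exists_analytic_root {F : ℂ → ℂ} (hF : AnalyticAt ℂ F 0) {m : ℕ} (hm0 : m ≠ 0)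
    (hlt : ∀ i < m, iteratedDeriv i F 0 = 0) (hm : iteratedDeriv m F 0 = m.factorial)
    (hconj : ∀ t, F (conj t) = conj (F t)) :
    ∃ φ : ℂ → ℂ, AnalyticAt ℂ φ 0 ∧ φ 0 = 0 ∧ deriv φ 0 = 1 ∧ (∀ᶠ t in 𝓝 0, φ t ^ m = F t) ∧
      ∀ᶠ t in 𝓝 0, φ (conj t) = conj (φ t) := by
  obtain ⟨G, hG, hG0, hFG⟩ := exists_eventually_eq_pow_mul hF hlt hm
  have G_zero_mem : G 0 ∈ Complex.slitPlane := hG0 ▸ Complex.one_mem_slitPlane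
  have analyticAt_root : AnalyticAt ℂ (fun t => G t ^ (m : ℂ)⁻¹) 0 :=
    hG.cpow analyticAt_const G_zero_mem
  refine ⟨fun t => t * G t ^ (m : ℂ)⁻¹, analyticAt_id.mul analyticAt_root, by simp, ?_, ?_, ?_⟩
  · have h := (hasDerivAt_id' (0 : ℂ)).fun_mul analyticAt_root.differentiableAt.hasDerivAt
    simpa [hG0] using h.deriv
  · filter_upwards [hFG] with t ht
    rw [ht, mul_pow, Complex.cpow_nat_inv_pow _ hm0]
  · have G_mem : ∀ᶠ t in 𝓝 0, G t ∈ Complex.slitPlane :=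
      hG.continuousAt.eventually (Complex.isOpen_slitPlane.mem_nhds G_zero_mem)
    filter_upwards [hFG, tendsto_conj_zero.eventually hFG, G_mem] with t ht ht_conj ht_mem
    rcases eq_or_ne t 0 with rfl | ht0
    · simp
    · have G_conj : G (conj t) = conj (G t) := by
        rw [hconj, ht, map_mul, map_pow] at ht_conj
        exact (mul_left_cancel₀ (pow_ne_zero m (by simpa using ht0)) ht_conj).symm
      rw [G_conj, map_mul, Complex.conj_cpow _ _ (Complex.mem_slitPlane_iff_arg.1 ht_mem).1]
      simp

theorem exists_analytic_inverse {φ : ℂ → ℂ} (hφ : AnalyticAt ℂ φ 0) (h0 : φ 0 = 0)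
    (h1 : deriv φ 0 = 1) (hconj : ∀ᶠ t in 𝓝 0, φ (conj t) = conj (φ t)) :
    ∃ T : ℂ → ℂ, AnalyticAt ℂ T 0 ∧ T 0 = 0 ∧ deriv T 0 = 1 ∧ (∀ᶠ z in 𝓝 0, φ (T z) = z) ∧
      ∀ᶠ z in 𝓝 0, conj (T (conj z)) = T z := by
  have deriv_ne_zero : deriv φ 0 ≠ 0 := h1 ▸ one_ne_zero
  set T := hφ.hasStrictDerivAt.localInverse _ _ _ deriv_ne_zero
  have hT : AnalyticAt ℂ T 0 := by simpa [h0] using hφ.analyticAt_localInverse deriv_ne_zero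
  have left_inverse : ∀ᶠ t in 𝓝 0, T (φ t) = t :=
    HasStrictDerivAt.eventually_left_inverse hφ.hasStrictDerivAt deriv_ne_zero
  have right_inverse : ∀ᶠ z in 𝓝 0, φ (T z) = z := by
    simpa [h0] using HasStrictDerivAt.eventually_right_inverse hφ.hasStrictDerivAt deriv_ne_zero
  have T_zero : T 0 = 0 := by simpa [h0] using left_inverse.self_of_nhds
  have T_tendsto : Tendsto T (𝓝 0) (𝓝 0) := by simpa [T_zero] using hT.continuousAt.tendsto
  refine ⟨T, hT, T_zero, ?_, right_inverse, ?_⟩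
  · have h := (HasStrictDerivAt.to_localInverse hφ.hasStrictDerivAt deriv_ne_zero).hasDerivAt.deriv
    simpa [h0, h1] using h
  · have T_conj_tendsto := T_tendsto.comp tendsto_conj_zero
    filter_upwards [(tendsto_conj_zero.comp T_conj_tendsto).eventually left_inverse,
      T_conj_tendsto.eventually hconj, tendsto_conj_zero.eventually right_inverse]
      with z hleft hcomm hright
    simp only [Function.comp_apply] at hleft hcomm
    rw [hcomm, hright, Complex.conj_conj] at hleft
    exact hleft.symm

theorem exists_inverse_of_pow {F : ℂ → ℂ} (hF : AnalyticAt ℂ F 0) {m : ℕ} (hm0 : m ≠ 0)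
    (hlt : ∀ i < m, iteratedDeriv i F 0 = 0) (hm : iteratedDeriv m F 0 = m.factorial)
    (hconj : ∀ t, F (conj t) = conj (F t)) :
    ∃ T : ℂ → ℂ, AnalyticAt ℂ T 0 ∧ T 0 = 0 ∧ deriv T 0 = 1 ∧ (∀ᶠ z in 𝓝 0, F (T z) = z ^ m) ∧
      ∀ᶠ z in 𝓝 0, conj (T (conj z)) = T z := by
  obtain ⟨φ, hφ, h0, h1, hroot, hφ_conj⟩ := exists_analytic_root hF hm0 hlt hm hconj
  obtain ⟨T, hT, hT0, hT1, hinv, hT_conj⟩ := exists_analytic_inverse hφ h0 h1 hφ_conj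
  have T_tendsto : Tendsto T (𝓝 0) (𝓝 0) := by simpa [hT0] using hT.continuousAt.tendsto
  refine ⟨T, hT, hT0, hT1, ?_, hT_conj⟩
  filter_upwards [hinv, T_tendsto.eventually hroot] with z hz hz_root
  rw [← hz_root, hz]

/-- The inverse branch `T z = z + O(z ^ 2)` of `normalizedPhase lam t = z ^ 3` at the origin, with
real Taylor coefficients. -/
structure IsCubicInverse (lam : ℝ) (T : ℂ → ℂ) : Prop where
  analyticAt : AnalyticAt ℂ T 0
  map_zero : T 0 = 0
  deriv_zero : deriv T 0 = 1
  normalizedPhase_eq : ∀ᶠ z in 𝓝 0, normalizedPhase lam (T z) = z ^ 3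
  conj_eq : ∀ᶠ z in 𝓝 0, conj (T (conj z)) = T z

theorem exists_isCubicInverse {lam : ℝ} (hlam : 0 < lam) : ∃ T, IsCubicInverse lam T := by
  obtain ⟨T, h, h0, h1, heq, hconj⟩ := exists_inverse_of_pow
    ((differentiable_normalizedPhase lam).analyticAt 0) three_ne_zero
    (fun _ => iteratedDeriv_normalizedPhase_zero_of_lt_three hlam)
    (by simp [iteratedDeriv_three_normalizedPhase_zero hlam, Nat.factorial])
    (normalizedPhase_conj lam)
  exact ⟨T, h, h0, h1, heq, hconj⟩

end LocalInverse

section TaylorSeries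

variable {𝕜 : Type*} [NontriviallyNormedField 𝕜]

/-- The formal Taylor series at the origin of a function of one variable. -/
noncomputable def taylorSeries (f : 𝕜 → 𝕜) : PowerSeries 𝕜 :=
  PowerSeries.mk fun n => iteratedDeriv n f 0 / n.factorial

theorem coeff_taylorSeries (f : 𝕜 → 𝕜) (n : ℕ) :
    (taylorSeries f).coeff n = iteratedDeriv n f 0 / n.factorial :=
  PowerSeries.coeff_mk _ _

theorem taylorSeries_congr {f g : 𝕜 → 𝕜} (h : f =ᶠ[𝓝 0] g) : taylorSeries f = taylorSeries g := by
  ext n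
  rw [coeff_taylorSeries, coeff_taylorSeries, h.iteratedDeriv_eq]

theorem taylorSeries_smul (c : 𝕜) (f : 𝕜 → 𝕜) : taylorSeries (c • f) = c • taylorSeries f := by
  ext n
  rw [coeff_taylorSeries, PowerSeries.coeff_smul, coeff_taylorSeries,
    iteratedDeriv_const_smul_field, smul_eq_mul, smul_eq_mul, mul_div_assoc]

theorem taylorSeries_pow_id [CharZero 𝕜] (m : ℕ) :
    taylorSeries (fun z : 𝕜 => z ^ m) = PowerSeries.X ^ m := by
  ext n
  rw [coeff_taylorSeries, iteratedDeriv_fun_pow_zero, PowerSeries.coeff_X_pow]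
  split_ifs with h
  · rw [h, div_self (Nat.cast_ne_zero.2 m.factorial_ne_zero)]
  · rw [Nat.cast_zero, zero_div]

theorem taylorSeries_deriv [CharZero 𝕜] (f : 𝕜 → 𝕜) :
    taylorSeries (deriv f) = PowerSeries.derivative 𝕜 (taylorSeries f) := by
  ext n
  have succ_ne_zero : (n : 𝕜) + 1 ≠ 0 := n.cast_add_one_ne_zero
  have factorial_ne_zero : (n.factorial : 𝕜) ≠ 0 := Nat.cast_ne_zero.2 n.factorial_ne_zero
  rw [PowerSeries.coeff_derivative, coeff_taylorSeries, coeff_taylorSeries, iteratedDeriv_succ',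
    Nat.factorial_succ]
  push_cast
  field_simp

variable [CompleteSpace 𝕜] {f g : 𝕜 → 𝕜}

theorem taylorSeries_add (hf : AnalyticAt 𝕜 f 0) (hg : AnalyticAt 𝕜 g 0) :
    taylorSeries (f + g) = taylorSeries f + taylorSeries g := by
  ext n
  rw [map_add, coeff_taylorSeries, coeff_taylorSeries, coeff_taylorSeries,
    iteratedDeriv_add hf.contDiffAt hg.contDiffAt, add_div]

theorem taylorSeries_mul [CharZero 𝕜] (hf : AnalyticAt 𝕜 f 0) (hg : AnalyticAt 𝕜 g 0) :
    taylorSeries (f * g) = taylorSeries f * taylorSeries g := by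
  ext n
  rw [coeff_taylorSeries, iteratedDeriv_mul hf.contDiffAt hg.contDiffAt, PowerSeries.coeff_mul,
    Finset.Nat.sum_antidiagonal_eq_sum_range_succ_mk, Finset.sum_div]
  refine Finset.sum_congr rfl fun i hi => ?_
  rw [coeff_taylorSeries, coeff_taylorSeries,
    Nat.cast_choose 𝕜 (Nat.lt_succ_iff.1 (Finset.mem_range.1 hi))]
  have factorial_ne_zero (k : ℕ) : (k.factorial : 𝕜) ≠ 0 := Nat.cast_ne_zero.2 k.factorial_ne_zero
  field_simp [factorial_ne_zero]

end TaylorSeries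

section ComplexTaylorSeries

variable {f : ℂ → ℂ}

theorem iteratedDeriv_conj_conj (f : ℂ → ℂ) (n : ℕ) :
    iteratedDeriv n (conj ∘ f ∘ conj) = conj ∘ iteratedDeriv n f ∘ conj := by
  induction n with
  | zero => simp
  | succ n ih => rw [iteratedDeriv_succ, ih, iteratedDeriv_succ, deriv_conj_conj]

theorem conj_coeff_taylorSeries (h : ∀ᶠ z in 𝓝 0, conj (f (conj z)) = f z) (n : ℕ) :
    conj ((taylorSeries f).coeff n) = (taylorSeries f).coeff n := by
  have conj_iteratedDeriv : conj (iteratedDeriv n f 0) = iteratedDeriv n f 0 := by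
    simpa [iteratedDeriv_conj_conj] using
      EventuallyEq.iteratedDeriv_eq (f := conj ∘ f ∘ conj) n h
  rw [coeff_taylorSeries, map_div₀, conj_iteratedDeriv, map_natCast]

theorem eventually_hasSum_taylorSeries (hf : AnalyticAt ℂ f 0) :
    ∀ᶠ z in 𝓝 0, HasSum (fun n => (taylorSeries f).coeff n * z ^ n) (f z) := by
  obtain ⟨r, hr, hball⟩ := Metric.eventually_nhds_iff_ball.1 hf.eventually_analyticAt
  have differentiableOn_ball : DifferentiableOn ℂ f (Metric.ball 0 r) := fun z hz =>
    (hball z hz).differentiableAt.differentiableWithinAt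
  filter_upwards [Metric.ball_mem_nhds 0 hr] with z hz
  refine (Complex.hasSum_taylorSeries_on_ball differentiableOn_ball hz).congr_fun fun n => ?_
  rw [coeff_taylorSeries, sub_zero, smul_eq_mul, smul_eq_mul]
  ring

end ComplexTaylorSeries

section CoefficientRecursion

open PowerSeries

variable {K : Type*} [Field K] {l : K} {T P : K⟦X⟧}

/-- The formal counterpart of `IsCubicInverse`, with `P` standing for `V' ∘ T` where `V` is the
normalized phase: the two differential equations are `(V ∘ T)' = 3 * X ^ 2` and
`(V' ∘ T)' = (V'' ∘ T) * T'`, the second one rewritten by means of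
`V'' = (1 - l) * V' + l * V + 6 * t`. -/
structure IsCubicInverseSeries (l : K) (T P : K⟦X⟧) : Prop where
  coeff_zero : coeff 0 T = 0
  coeff_one : coeff 1 T = 1
  mul_derivative : P * derivative K T = (3 : K) • X ^ 2
  derivative_eq : derivative K P =
    (3 * (1 - l)) • X ^ 2 + (l • X ^ 3 + (6 : K) • T) * derivative K T

namespace IsCubicInverseSeries

theorem sum_coeff_mul (h : IsCubicInverseSeries l T P) (n : ℕ) :
    ∑ i ∈ Finset.range (n + 1), coeff i P * coeff (n - i) (derivative K T) =
      if n = 2 then 3 else 0 := by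
  have hn := congrArg (coeff n) h.mul_derivative
  rw [coeff_mul, Finset.Nat.sum_antidiagonal_eq_sum_range_succ_mk] at hn
  simpa [coeff_X_pow] using hn

theorem succ_mul_coeff_succ (h : IsCubicInverseSeries l T P) (n : ℕ) :
    (n + 1) * coeff (n + 1) P = (if n = 2 then 3 * (1 - l) else 0) +
      ∑ i ∈ Finset.range (n + 1),
        ((if i = 3 then l else 0) + 6 * coeff i T) * coeff (n - i) (derivative K T) := by
  have hn := congrArg (coeff n) h.derivative_eq
  rw [map_add, coeff_mul, Finset.Nat.sum_antidiagonal_eq_sum_range_succ_mk] at hn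
  simpa [coeff_X_pow, coeff_derivative, mul_comm] using hn

variable [CharZero K]

theorem coeff_of_le_two (h : IsCubicInverseSeries l T P) :
    coeff 0 P = 0 ∧ coeff 1 P = 0 ∧ coeff 2 P = 3 := by
  have p0 : coeff 0 P = 0 := by
    simpa [h.coeff_one, coeff_derivative] using h.sum_coeff_mul 0
  have p1 : coeff 1 P = 0 := by
    simpa [h.coeff_zero] using h.succ_mul_coeff_succ 0
  refine ⟨p0, p1, ?_⟩
  simpa [Finset.sum_range_succ, -coeff_zero_eq_constantCoeff, coeff_derivative, p0, p1,
    h.coeff_one] using h.sum_coeff_mul 2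

open Finset in
-- At order `n` the two equations involve, besides known coefficients, only `coeff (n - 1) T` and
-- `coeff n P`, which they determine.
theorem coeff_of_le_four (h : IsCubicInverseSeries l T P) :
    coeff 2 T = (-1 + l) / 12 ∧ coeff 3 T = (1 - 6 * l + l ^ 2) / 240 ∧
      coeff 4 T = (5 + 93 * l - 93 * l ^ 2 - 5 * l ^ 3) / 25920 ∧
      coeff 3 P = (1 - l) / 2 ∧ coeff 4 P = (11 + 14 * l + 11 * l ^ 2) / 240 ∧
      coeff 5 P = (-1 + 3 * l - 3 * l ^ 2 + l ^ 3) / 1080 := by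
  have c0 := h.coeff_zero
  have c1 := h.coeff_one
  obtain ⟨p0, p1, p2⟩ := h.coeff_of_le_two
  have e3 := h.sum_coeff_mul 3
  have d3 := h.succ_mul_coeff_succ 2
  norm_num [sum_range_succ, coeff_derivative, -coeff_zero_eq_constantCoeff, c0, c1, p0, p1, p2]
      at e3 d3
  have c2 : coeff 2 T = (-1 + l) / 12 := by
    linear_combination (e3 - d3 / 3) / 12
  have p3 : coeff 3 P = (1 - l) / 2 := by
    linear_combination e3 - 6 * c2
  have e4 := h.sum_coeff_mul 4
  have d4 := h.succ_mul_coeff_succ 3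
  norm_num [sum_range_succ, coeff_derivative, -coeff_zero_eq_constantCoeff, c0, c1, p0, p1, p2, c2,
    p3]
      at e4 d4
  have c3 : coeff 3 T = (1 - 6 * l + l ^ 2) / 240 := by
    linear_combination (e4 - d4 / 4) / 15
  have p4 : coeff 4 P = (11 + 14 * l + 11 * l ^ 2) / 240 := by
    linear_combination e4 - 9 * c3
  have e5 := h.sum_coeff_mul 5
  have d5 := h.succ_mul_coeff_succ 4
  norm_num [sum_range_succ, coeff_derivative, -coeff_zero_eq_constantCoeff, c0, c1, p0, p1, p2, c2,
    p3, c3, p4]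
      at e5 d5
  have c4 : coeff 4 T = (5 + 93 * l - 93 * l ^ 2 - 5 * l ^ 3) / 25920 := by
    linear_combination (e5 - d5 / 5) / 18
  have p5 : coeff 5 P = (-1 + 3 * l - 3 * l ^ 2 + l ^ 3) / 1080 := by
    linear_combination e5 - 12 * c4
  exact ⟨c2, c3, c4, p3, p4, p5⟩

open Finset in
theorem coeff_of_le_seven (h : IsCubicInverseSeries l T P) :
    coeff 5 T = (-277 - 836 * l + 6114 * l ^ 2 - 836 * l ^ 3 - 277 * l ^ 4) / 5443200 ∧
      coeff 6 T = (1 - 61 * l - 254 * l ^ 2 + 254 * l ^ 3 + 61 * l ^ 4 - l ^ 5) / 1612800 ∧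
      coeff 7 T = (959 + 7098 * l - 2031 * l ^ 2 - 58708 * l ^ 3 - 2031 * l ^ 4 + 7098 * l ^ 5 +
        959 * l ^ 6) / 1175731200 := by
  have c0 := h.coeff_zero
  have c1 := h.coeff_one
  obtain ⟨p0, p1, p2⟩ := h.coeff_of_le_two
  obtain ⟨c2, c3, c4, p3, p4, p5⟩ := h.coeff_of_le_four
  have e6 := h.sum_coeff_mul 6
  have d6 := h.succ_mul_coeff_succ 5
  norm_num [sum_range_succ, coeff_derivative, -coeff_zero_eq_constantCoeff, c0, c1, p0, p1, p2, c2,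
    p3, c3, p4, c4, p5]
      at e6 d6
  have c5 : coeff 5 T = (-277 - 836 * l + 6114 * l ^ 2 - 836 * l ^ 3 - 277 * l ^ 4) / 5443200 := by
    linear_combination (e6 - d6 / 6) / 21
  have p6 : coeff 6 P = (-47 - 156 * l - 26 * l ^ 2 - 156 * l ^ 3 - 47 * l ^ 4) / 134400 := by
    linear_combination e6 - 15 * c5
  have e7 := h.sum_coeff_mul 7
  have d7 := h.succ_mul_coeff_succ 6
  norm_num [sum_range_succ, coeff_derivative, -coeff_zero_eq_constantCoeff, c0, c1, p0, p1, p2, c2,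
    p3, c3, p4, c4, p5, c5, p6]
      at e7 d7
  have c6 : coeff 6 T =
      (1 - 61 * l - 254 * l ^ 2 + 254 * l ^ 3 + 61 * l ^ 4 - l ^ 5) / 1612800 := by
    linear_combination (e7 - d7 / 7) / 24
  have p7 : coeff 7 P =
      (37 - 5 * l - 170 * l ^ 2 + 170 * l ^ 3 + 5 * l ^ 4 - 37 * l ^ 5) / 1088640 := by
    linear_combination e7 - 18 * c6
  have e8 := h.sum_coeff_mul 8
  have d8 := h.succ_mul_coeff_succ 7
  norm_num [sum_range_succ, coeff_derivative, -coeff_zero_eq_constantCoeff, c0, c1, p0, p1, p2, c2,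
    p3, c3, p4, c4, p5, c5, p6, c6, p7]
      at e8 d8
  have c7 : coeff 7 T =
      (959 + 7098 * l - 2031 * l ^ 2 - 58708 * l ^ 3 - 2031 * l ^ 4 + 7098 * l ^ 5 +
        959 * l ^ 6) / 1175731200 := by
    linear_combination (e8 - d8 / 8) / 27
  exact ⟨c5, c6, c7⟩

end IsCubicInverseSeries

end CoefficientRecursion

theorem IsCubicInverse.isCubicInverseSeries {lam : ℝ} (hlam : 0 < lam) {T : ℂ → ℂ}
    (hT : IsCubicInverse lam T) :
    IsCubicInverseSeries (lam : ℂ) (taylorSeries T)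
      (taylorSeries (deriv (normalizedPhase lam) ∘ T)) := by
  have V_diff := differentiable_normalizedPhase lam
  have V'_diff : Differentiable ℂ (deriv (normalizedPhase lam)) :=
    (V_diff.contDiff (n := 2)).differentiable_deriv_two
  have deriv_comp {f : ℂ → ℂ} (hf : Differentiable ℂ f) :
      deriv (f ∘ T) =ᶠ[𝓝 0] (deriv f ∘ T) * deriv T :=
    hT.analyticAt.eventually_analyticAt.mono fun z hz =>
      _root_.deriv_comp z (hf _) hz.differentiableAt
  have T'_analyticAt : AnalyticAt ℂ (deriv T) 0 := hT.analyticAt.deriv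
  have V'_analyticAt : AnalyticAt ℂ (deriv (normalizedPhase lam) ∘ T) 0 :=
    (V'_diff.analyticAt _).comp hT.analyticAt
  have cube : normalizedPhase lam ∘ T =ᶠ[𝓝 0] fun z => z ^ 3 := hT.normalizedPhase_eq
  have mul_deriv : (deriv (normalizedPhase lam) ∘ T) * deriv T =ᶠ[𝓝 0]
      (3 : ℂ) • fun z => z ^ 2 :=
    (deriv_comp V_diff).symm.trans (cube.deriv.trans (.of_forall fun z => by simp))
  have deriv_V' : deriv (deriv (normalizedPhase lam) ∘ T) =ᶠ[𝓝 0]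
      (3 * (1 - lam : ℂ)) • (fun z => z ^ 2) +
        ((lam : ℂ) • (fun z => z ^ 3) + (6 : ℂ) • T) * deriv T := by
    filter_upwards [deriv_comp V'_diff, mul_deriv, cube] with z hz hmul hcube
    simp only [Pi.mul_apply, Pi.add_apply, Pi.smul_apply, Function.comp_apply, smul_eq_mul]
      at hz hmul hcube ⊢
    rw [hz, deriv_deriv_normalizedPhase hlam, hcube]
    linear_combination (1 - (lam : ℂ)) * hmul
  refine ⟨?_, ?_, ?_, ?_⟩
  · simp [coeff_taylorSeries, hT.map_zero]
  · simp [coeff_taylorSeries, hT.deriv_zero]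
  · rw [← taylorSeries_deriv, ← taylorSeries_mul V'_analyticAt T'_analyticAt,
      taylorSeries_congr mul_deriv, taylorSeries_smul, taylorSeries_pow_id]
  · have cubic_analyticAt : AnalyticAt ℂ ((lam : ℂ) • fun z : ℂ => z ^ 3) 0 := by fun_prop
    have linear_analyticAt : AnalyticAt ℂ ((6 : ℂ) • T) 0 := hT.analyticAt.const_smul
    rw [← taylorSeries_deriv, taylorSeries_congr deriv_V', taylorSeries_add (by fun_prop)
      ((cubic_analyticAt.add linear_analyticAt).mul T'_analyticAt),
      taylorSeries_mul (cubic_analyticAt.add linear_analyticAt) T'_analyticAt,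
      taylorSeries_add cubic_analyticAt linear_analyticAt]
    simp only [taylorSeries_smul, taylorSeries_pow_id, taylorSeries_deriv]

section UpperBranch

variable {lam : ℝ}

/-- The slope `2^(2/3) e^(πi/3) H^(-1/3)` of the upper branch `u = U(w)` at `w = 0`. -/
noncomputable def branchSlope (lam : ℝ) : ℂ :=
  (((2 : ℝ) ^ (2 / 3 : ℝ) / bigH lam ^ (1 / 3 : ℝ) : ℝ) : ℂ) * Complex.exp ((π : ℂ) * Complex.I / 3)

/-- The upper branch `u = U(w)` obtained from a local inverse `T` of the normalized phase. -/
noncomputable def upperBranch (lam : ℝ) (T : ℂ → ℂ) (w : ℂ) : ℂ :=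
  doubleSaddle lam + T (branchSlope lam * w)

/-- The coefficients `B k` of `dU/dw`, read off from the Taylor coefficients of `T`. -/
noncomputable def saddleCoeff (T : ℂ → ℂ) (k : ℕ) : ℝ :=
  ((2 : ℝ) ^ (2 / 3 : ℝ)) ^ k * ((k + 1) * ((taylorSeries T).coeff (k + 1)).re)

theorem cexp_pi_third_pow_three : Complex.exp ((π : ℂ) * Complex.I / 3) ^ 3 = -1 := by
  rw [← Complex.exp_nat_mul, ← Complex.exp_pi_mul_I]
  congr 1
  push_cast
  ring

theorem bigH_mul_branchSlope_pow_three (hlam : 0 < lam) :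
    (bigH lam : ℂ) * branchSlope lam ^ 3 = -4 := by
  have H_pos := bigH_pos hlam
  have scale_pow : ((2 : ℝ) ^ (2 / 3 : ℝ) / bigH lam ^ (1 / 3 : ℝ)) ^ 3 = 4 / bigH lam := by
    rw [div_pow, ← Real.rpow_mul_natCast two_pos.le, ← Real.rpow_mul_natCast H_pos.le]
    norm_num
  have H_ne : (bigH lam : ℂ) ≠ 0 := by exact_mod_cast H_pos.ne'
  rw [branchSlope, mul_pow, cexp_pi_third_pow_three, ← Complex.ofReal_pow, scale_pow]
  push_cast
  field_simp

theorem tendsto_branchSlope_mul (lam : ℝ) :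
    Tendsto (fun w : ℂ => branchSlope lam * w) (𝓝 0) (𝓝 0) := by
  simpa using (continuous_const_mul (branchSlope lam)).tendsto 0

theorem deriv_upperBranch (lam : ℝ) (T : ℂ → ℂ) (w : ℂ) :
    deriv (upperBranch lam T) w = branchSlope lam * deriv T (branchSlope lam * w) := by
  unfold upperBranch
  rw [deriv_const_add, deriv_comp_mul_left, smul_eq_mul]

theorem IsCubicInverse.isUpperBranch {T : ℂ → ℂ} (hlam : 0 < lam) (hT : IsCubicInverse lam T) :
    IsUpperBranch lam (coalescenceRatio lam) (upperBranch lam T) where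
  analyticAt := by
    have comp : AnalyticAt ℂ (fun w => T (branchSlope lam * w)) 0 :=
      AnalyticAt.comp (by simpa using hT.analyticAt) (by fun_prop)
    exact analyticAt_const.add comp
  map_zero := by simp [upperBranch, hT.map_zero]
  deriv_zero := by rw [deriv_upperBranch, mul_zero, hT.deriv_zero, mul_one, branchSlope]
  phase_eq := by
    filter_upwards [(tendsto_branchSlope_mul lam).eventually hT.normalizedPhase_eq] with w hw
    rw [upperBranch, phase_doubleSaddle_add hlam, hw]
    linear_combination (w ^ 3 / 12) * bigH_mul_branchSlope_pow_three hlam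

theorem IsCubicInverse.ofReal_re_coeff {T : ℂ → ℂ} (hT : IsCubicInverse lam T) (n : ℕ) :
    (((taylorSeries T).coeff n).re : ℂ) = (taylorSeries T).coeff n :=
  Complex.conj_eq_iff_re.1 (conj_coeff_taylorSeries hT.conj_eq n)

theorem IsCubicInverse.isSaddleCoeff {T : ℂ → ℂ} (hlam : 0 < lam) (hT : IsCubicInverse lam T) :
    IsSaddleCoeff lam (coalescenceRatio lam) (saddleCoeff T) := by
  refine ⟨upperBranch lam T, hT.isUpperBranch hlam, ?_⟩
  filter_upwards [(tendsto_branchSlope_mul lam).eventually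
    (eventually_hasSum_taylorSeries hT.analyticAt.deriv)] with w hw
  rw [deriv_upperBranch]
  refine (hw.mul_left (branchSlope lam)).congr_fun fun k => ?_
  have exp_succ : Complex.exp ((π : ℂ) * Complex.I * ((k : ℂ) + 1) / 3) =
      Complex.exp ((π : ℂ) * Complex.I / 3) ^ (k + 1) := by
    rw [← Complex.exp_nat_mul]
    congr 1
    push_cast
    ring
  have H_rpow : bigH lam ^ ((k : ℝ) / 3) = (bigH lam ^ (1 / 3 : ℝ)) ^ k := by
    rw [← Real.rpow_mul_natCast (bigH_pos hlam).le, one_div_mul_eq_div]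
  rw [exp_succ, H_rpow, saddleCoeff, taylorSeries_deriv, PowerSeries.coeff_derivative, branchSlope]
  push_cast
  rw [hT.ofReal_re_coeff]
  ring

theorem saddleCoeff_eq_of_coeff_eq {T : ℂ → ℂ} {k : ℕ} {y : ℝ}
    (h : (taylorSeries T).coeff (k + 1) = (y : ℂ)) :
    saddleCoeff T k = ((2 : ℝ) ^ (2 / 3 : ℝ)) ^ k * ((k + 1) * y) := by
  rw [saddleCoeff, h, Complex.ofReal_re]

theorem IsCubicInverse.saddleCoeff_eq {T : ℂ → ℂ} (hlam : 0 < lam) (hT : IsCubicInverse lam T) :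
    saddleCoeff T 0 = 1 ∧
    saddleCoeff T 1 = (lam - 1) / ((2 : ℝ) ^ (1 / 3 : ℝ) * 3) ∧
    saddleCoeff T 2 = (1 - 6 * lam + lam ^ 2) / ((2 : ℝ) ^ (2 / 3 : ℝ) * 20) ∧
    saddleCoeff T 3 = (5 + 93 * lam - 93 * lam ^ 2 - 5 * lam ^ 3) / 1620 ∧
    saddleCoeff T 4 = -(277 + 836 * lam - 6114 * lam ^ 2 + 836 * lam ^ 3 + 277 * lam ^ 4) /
      ((2 : ℝ) ^ (1 / 3 : ℝ) * 136080) ∧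
    saddleCoeff T 5 = (1 - 61 * lam - 254 * lam ^ 2 + 254 * lam ^ 3 + 61 * lam ^ 4 - lam ^ 5) /
      ((2 : ℝ) ^ (2 / 3 : ℝ) * 16800) ∧
    saddleCoeff T 6 = (959 + 7098 * lam - 2031 * lam ^ 2 - 58708 * lam ^ 3 - 2031 * lam ^ 4 +
      7098 * lam ^ 5 + 959 * lam ^ 6) / 10497600 := by
  have series := hT.isCubicInverseSeries hlam
  obtain ⟨t2, t3, t4, -⟩ := series.coeff_of_le_four
  obtain ⟨t5, t6, t7⟩ := series.coeff_of_le_seven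
  have t1 : (taylorSeries T).coeff (0 + 1) = ((1 : ℝ) : ℂ) := by
    rw [Complex.ofReal_one]
    exact series.coeff_one
  set d : ℝ := (2 : ℝ) ^ (1 / 3 : ℝ) with hd
  have d_pos : 0 < d := by positivity
  have d_pow_three : d ^ 3 = 2 := by
    rw [hd, ← Real.rpow_mul_natCast two_pos.le]
    norm_num
  have d_sq : (2 : ℝ) ^ (2 / 3 : ℝ) = d ^ 2 := by
    rw [hd, ← Real.rpow_mul_natCast two_pos.le]
    norm_num
  rw [saddleCoeff_eq_of_coeff_eq t1, saddleCoeff_eq_of_coeff_eq (mod_cast t2),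
    saddleCoeff_eq_of_coeff_eq (mod_cast t3), saddleCoeff_eq_of_coeff_eq (mod_cast t4),
    saddleCoeff_eq_of_coeff_eq (mod_cast t5), saddleCoeff_eq_of_coeff_eq (mod_cast t6),
    saddleCoeff_eq_of_coeff_eq (mod_cast t7), d_sq]
  have d_pow (m : ℕ) : d ^ (3 * m) = 2 ^ m := by rw [pow_mul, d_pow_three]
  refine ⟨by norm_num, ?_, ?_, ?_, ?_, ?_, ?_⟩
  all_goals
    field_simp
    simp only [d_pow_three, d_pow 2, d_pow 3, d_pow 4]
    push_cast
    ring

end UpperBranch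

section Watson

variable {E : Type*} [NormedAddCommGroup E] [NormedSpace ℝ E]

/-- The value of the moment `∫₀^∞ w ^ k e ^ (-x w ^ p) dw`, the coefficient functions of the
expansion in Watson's lemma. -/
noncomputable def watsonMoment (p : ℝ) (k : ℕ) (x : ℝ) : ℝ :=
  x ^ (-((k : ℝ) + 1) / p) * (1 / p) * Real.Gamma ((k + 1) / p)

variable {p x : ℝ}

theorem integrableOn_exp_neg_mul_rpow_mul_pow (hp : 0 < p) (hx : 0 < x) (k : ℕ) :
    IntegrableOn (fun w : ℝ => Real.exp (-x * w ^ p) * w ^ k) (Ioi 0) := by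
  simpa only [Real.rpow_natCast, mul_comm] using
    integrableOn_rpow_mul_exp_neg_mul_rpow (neg_one_lt_zero.trans_le k.cast_nonneg) hp hx

theorem integral_exp_neg_mul_rpow_mul_pow (hp : 0 < p) (hx : 0 < x) (k : ℕ) :
    ∫ w in Ioi (0 : ℝ), Real.exp (-x * w ^ p) * w ^ k = watsonMoment p k x := by
  simpa only [Real.rpow_natCast, mul_comm, watsonMoment] using
    integral_rpow_mul_exp_neg_mul_rpow hp (neg_one_lt_zero.trans_le k.cast_nonneg) hx

theorem norm_integral_exp_smul_le {φ : ℝ → E} {C : ℝ} {N : ℕ} (hp : 0 < p) (hx : 0 < x)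
    (hφ : ∀ w ∈ Ioi 0, ‖φ w‖ ≤ C * w ^ N) :
    ‖∫ w in Ioi (0 : ℝ), Real.exp (-x * w ^ p) • φ w‖ ≤ C * watsonMoment p N x := by
  rw [← integral_exp_neg_mul_rpow_mul_pow hp hx, ← integral_const_mul]
  refine norm_integral_le_of_norm_le
    ((integrableOn_exp_neg_mul_rpow_mul_pow hp hx N).const_mul C) ?_
  filter_upwards [ae_restrict_mem measurableSet_Ioi] with w hw
  rw [norm_smul, Real.norm_of_nonneg (Real.exp_pos _).le, mul_left_comm]
  exact mul_le_mul_of_nonneg_left (hφ w hw) (Real.exp_pos _).le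

theorem exists_norm_indicator_sub_sum_le {g : ℝ → E} {c : ℕ → E} {N : ℕ} {δ C : ℝ} (hδ : 0 < δ)
    (hC : ∀ w ∈ Ioc 0 δ, ‖g w - ∑ k ∈ Finset.range N, w ^ k • c k‖ ≤ C * w ^ N) :
    ∃ D, ∀ w ∈ Ioi 0,
      ‖(Ioc 0 δ).indicator g w - ∑ k ∈ Finset.range N, w ^ k • c k‖ ≤ D * w ^ N := by
  refine ⟨max C (∑ k ∈ Finset.range N, (δ ^ (N - k))⁻¹ * ‖c k‖), fun w (hw : 0 < w) => ?_⟩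
  rcases le_or_gt w δ with le_delta | delta_lt
  · rw [indicator_of_mem (mem_Ioc.2 ⟨hw, le_delta⟩)]
    exact (hC w ⟨hw, le_delta⟩).trans (by gcongr; exact le_max_left _ _)
  · rw [indicator_of_notMem (notMem_Ioc_of_gt delta_lt), zero_sub, norm_neg]
    refine le_trans ?_ (mul_le_mul_of_nonneg_right (le_max_right _ _) (by positivity))
    rw [Finset.sum_mul]
    refine (norm_sum_le _ _).trans (Finset.sum_le_sum fun k hk => ?_)
    have pow_le : δ ^ (N - k) * w ^ k ≤ w ^ N := by
      rw [← pow_sub_mul_pow w (Finset.mem_range.1 hk).le]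
      gcongr
    rw [norm_smul, Real.norm_of_nonneg (by positivity), mul_right_comm]
    gcongr
    rwa [le_inv_mul_iff₀ (by positivity)]

variable [CompleteSpace E]

theorem exists_norm_integral_exp_smul_sub_sum_le {g : ℝ → E} {c : ℕ → E} {N : ℕ} {δ C : ℝ}
    (hp : 0 < p) (hδ : 0 < δ) (hg : IntegrableOn g (Ioc 0 δ))
    (hC : ∀ w ∈ Ioc 0 δ, ‖g w - ∑ k ∈ Finset.range N, w ^ k • c k‖ ≤ C * w ^ N) :
    ∃ D, ∀ x > 0, ‖(∫ w in (0 : ℝ)..δ, Real.exp (-x * w ^ p) • g w) -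
      ∑ k ∈ Finset.range N, watsonMoment p k x • c k‖ ≤ D * watsonMoment p N x := by
  obtain ⟨D, hD⟩ := exists_norm_indicator_sub_sum_le hδ hC
  refine ⟨D, fun x hx => le_trans (le_of_eq ?_) (norm_integral_exp_smul_le hp hx hD)⟩
  have weight_continuous : Continuous fun w : ℝ => Real.exp (-x * w ^ p) := by
    have := Real.continuous_rpow_const hp.le
    fun_prop
  have smul_indicator (w : ℝ) : Real.exp (-x * w ^ p) • (Ioc 0 δ).indicator g w =
      (Ioc 0 δ).indicator (fun w => Real.exp (-x * w ^ p) • g w) w :=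
    (indicator_smul_apply (Ioc 0 δ) (fun w => Real.exp (-x * w ^ p)) g w).symm
  have truncated_integrable :
      IntegrableOn ((Ioc 0 δ).indicator fun w => Real.exp (-x * w ^ p) • g w) (Ioi 0) := by
    have smul_integrable : IntegrableOn (fun w => Real.exp (-x * w ^ p) • g w) (Ioc 0 δ) :=
      hg.continuousOn_smul_of_subset weight_continuous.continuousOn isCompact_Icc
        measurableSet_Ioc Ioc_subset_Icc_self
    exact (smul_integrable.integrable_indicator measurableSet_Ioc).integrableOn
  have term_integrable (k : ℕ) :
      IntegrableOn (fun w => (Real.exp (-x * w ^ p) * w ^ k) • c k) (Ioi 0) :=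
    (integrableOn_exp_neg_mul_rpow_mul_pow hp hx k).smul_const _
  simp only [smul_sub, Finset.smul_sum, smul_smul, smul_indicator]
  rw [integral_sub truncated_integrable (integrable_finsetSum _ fun k _ => term_integrable k),
    integral_finsetSum _ fun k _ => term_integrable k,
    setIntegral_indicator measurableSet_Ioc, Set.inter_eq_right.2 Ioc_subset_Ioi_self,
    intervalIntegral.integral_of_le hδ.le]
  simp only [integral_smul_const, integral_exp_neg_mul_rpow_mul_pow hp hx]

theorem watson_isBigO {g : ℝ → E} {c : ℕ → E} {N : ℕ} {δ C : ℝ} (hp : 0 < p) (hδ : 0 < δ)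
    (hg : IntegrableOn g (Ioc 0 δ))
    (hC : ∀ w ∈ Ioc 0 δ, ‖g w - ∑ k ∈ Finset.range N, w ^ k • c k‖ ≤ C * w ^ N) :
    (fun x : ℝ => (∫ w in (0 : ℝ)..δ, Real.exp (-x * w ^ p) • g w) -
      ∑ k ∈ Finset.range N, watsonMoment p k x • c k) =O[atTop]
    fun x => x ^ (-((N : ℝ) + 1) / p) := by
  obtain ⟨D, hD⟩ := exists_norm_integral_exp_smul_sub_sum_le hp hδ hg hC
  refine IsBigO.of_bound (D * (1 / p * Real.Gamma ((N + 1) / p))) ?_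
  filter_upwards [eventually_gt_atTop 0] with x hx
  refine (hD x hx).trans_eq ?_
  rw [Real.norm_of_nonneg (by positivity), watsonMoment]
  ring

end Watson

section ExponentialPrimitive

theorem isBigO_exp_mul_of_lt {b c : ℝ} (hbc : b < c) (s : ℝ) :
    (fun x : ℝ => Real.exp (x * b)) =O[atTop] fun x => Real.exp (x * c) * x ^ s := by
  refine ((isBigO_refl (fun x : ℝ => Real.exp (x * c)) atTop).mul
    (isLittleO_exp_neg_mul_rpow_atTop (sub_pos.2 hbc) s).isBigO).congr_left fun x => ?_
  rw [← Real.exp_add]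
  congr 1
  ring

theorem primitive_sub_isBigO_of_segment {h : ℂ → ℂ} {P : ℝ → ℂ → ℂ} {c : ℝ} {A B : ℂ}
    (hh : ContinuousOn h (segment ℝ A B)) (hlt : ∀ u ∈ segment ℝ A B, (h u).re < c)
    (hP : ∀ x, ∀ u ∈ segment ℝ A B, HasDerivAt (P x) (Complex.exp (x * h u)) u) (s : ℝ) :
    (fun x => P x B - P x A) =O[atTop] fun x : ℝ => Real.exp (x * c) * x ^ s := by
  have segment_compact : IsCompact (segment ℝ A B) := by
    rw [← convexHull_pair]
    exact (Set.toFinite _).isCompact_convexHull ℝ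
  obtain ⟨u₀, hu₀, hmax⟩ := segment_compact.exists_isMaxOn ⟨A, left_mem_segment ℝ A B⟩
    (Complex.continuous_re.comp_continuousOn hh)
  refine IsBigO.trans (IsBigO.of_bound ‖B - A‖ ?_) (isBigO_exp_mul_of_lt (hlt u₀ hu₀) s)
  filter_upwards [eventually_ge_atTop 0] with x hx
  rw [Real.norm_of_nonneg (Real.exp_pos _).le, mul_comm]
  refine (convex_segment A B).norm_image_sub_le_of_norm_hasDerivWithin_le (𝕜 := ℂ)
    (fun u hu => (hP x u hu).hasDerivWithinAt) (fun u hu => ?_) (left_mem_segment ℝ A B)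
    (right_mem_segment ℝ A B)
  rw [Complex.norm_exp, Complex.re_ofReal_mul]
  have re_le : (h u).re ≤ (h u₀).re := hmax hu
  gcongr

theorem exists_tendsto_of_norm_deriv_le_exp {E : Type*} [NormedAddCommGroup E] [NormedSpace ℝ E]
    [CompleteSpace E] {f : ℝ → E} {M k r : ℝ} (hk : 0 < k) (hf : Differentiable ℝ f)
    (hbound : ∀ ρ ∈ Ioi r, ‖deriv f ρ‖ ≤ M * Real.exp (-k * (ρ - r))) :
    ∃ L, Tendsto f atTop (𝓝 L) ∧ ‖L - f r‖ ≤ M / k := by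
  have bound_ae : ∀ᵐ ρ ∂volume.restrict (Ioi r), ‖deriv f ρ‖ ≤ M * Real.exp (-k * (ρ - r)) :=
    (ae_restrict_mem measurableSet_Ioi).mono hbound
  have exp_eq (ρ : ℝ) :
      M * Real.exp (-k * (ρ - r)) = M * Real.exp (k * r) * Real.exp (-k * ρ) := by
    rw [mul_assoc, ← Real.exp_add]
    congr 2
    ring
  have bound_integrable : IntegrableOn (fun ρ => M * Real.exp (-k * (ρ - r))) (Ioi r) := by
    simp only [exp_eq]
    exact (integrableOn_exp_mul_Ioi (neg_lt_zero.2 hk) r).const_mul _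
  have bound_integral : ∫ ρ in Ioi r, M * Real.exp (-k * (ρ - r)) = M / k := by
    simp only [exp_eq]
    rw [integral_const_mul, integral_exp_mul_Ioi (neg_lt_zero.2 hk), neg_div_neg_eq, mul_div_assoc',
      mul_assoc, ← Real.exp_add, neg_mul, add_neg_cancel, Real.exp_zero, mul_one]
  have deriv_integrable : IntegrableOn (deriv f) (Ioi r) :=
    bound_integrable.mono' (aestronglyMeasurable_deriv _ _) bound_ae
  have hasDerivAt (ρ : ℝ) : HasDerivAt f (deriv f ρ) ρ := (hf ρ).hasDerivAt
  have limit := tendsto_limUnder_of_hasDerivAt_of_integrableOn_Ioi (fun ρ _ => hasDerivAt ρ)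
    deriv_integrable
  refine ⟨limUnder atTop f, limit, ?_⟩
  rw [← integral_Ioi_of_hasDerivAt_of_tendsto' (fun ρ _ => hasDerivAt ρ) deriv_integrable limit,
    ← bound_integral]
  exact norm_integral_le_of_norm_le bound_integrable bound_ae

theorem exists_tendsto_primitive_horizontal {h P : ℂ → ℂ} {b k r τ x : ℝ} (hk : 0 < k)
    (hx : 1 ≤ x) (hP : ∀ u, HasDerivAt P (Complex.exp (x * h u)) u)
    (hre : ∀ ρ ∈ Ioi r, (h (ρ + τ * Complex.I)).re ≤ b - k * (ρ - r)) :
    ∃ L, Tendsto (fun ρ : ℝ => P (ρ + τ * Complex.I)) atTop (𝓝 L) ∧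
      ‖L - P (r + τ * Complex.I)‖ ≤ Real.exp (x * b) / k := by
  have hasDerivAt (ρ : ℝ) : HasDerivAt (fun ρ : ℝ => P (ρ + τ * Complex.I))
      (Complex.exp (x * h (ρ + τ * Complex.I))) ρ :=
    ((hP _).comp_add_const (ρ : ℂ) (τ * Complex.I)).comp_ofReal
  refine exists_tendsto_of_norm_deriv_le_exp hk (fun ρ => (hasDerivAt ρ).differentiableAt)
    fun ρ hρ => ?_
  rw [(hasDerivAt ρ).deriv, Complex.norm_exp, Complex.re_ofReal_mul, ← Real.exp_add]
  have decay_nonneg : 0 ≤ k * (ρ - r) := mul_nonneg hk.le (sub_nonneg.2 (le_of_lt hρ))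
  refine Real.exp_le_exp.2 ?_
  linarith [mul_le_mul_of_nonneg_left (hre ρ hρ) (zero_le_one.trans hx),
    le_mul_of_one_le_left decay_nonneg hx]

end ExponentialPrimitive

section DescentDirection

theorem eventually_re_neg_of_re_pow_neg {F : ℂ → ℂ} {m : ℕ} (hF : AnalyticAt ℂ F 0)
    (hlt : ∀ i < m, iteratedDeriv i F 0 = 0) (hm : iteratedDeriv m F 0 = m.factorial) {c : ℂ}
    (hc : (c ^ m).re < 0) :
    ∀ᶠ q : ℝ × ℂ in 𝓝[>] 0 ×ˢ 𝓝 c, (F (q.1 * q.2)).re < 0 := by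
  obtain ⟨G, hG, hG0, hFG⟩ := exists_eventually_eq_pow_mul hF hlt hm
  have nhdsGT_le : 𝓝[>] (0 : ℝ) ×ˢ 𝓝 c ≤ 𝓝 (0, c) :=
    (Filter.prod_mono nhdsWithin_le_nhds le_rfl).trans_eq (nhds_prod_eq).symm
  have mul_tendsto : Tendsto (fun q : ℝ × ℂ => (q.1 : ℂ) * q.2) (𝓝[>] 0 ×ˢ 𝓝 c) (𝓝 0) :=
    (Continuous.tendsto' (by fun_prop) _ _ (by simp)).mono_left nhdsGT_le
  have snd_tendsto : Tendsto (fun q : ℝ × ℂ => q.2 ^ m) (𝓝[>] 0 ×ˢ 𝓝 c) (𝓝 (c ^ m)) :=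
    (Continuous.tendsto' (by fun_prop) _ _ rfl).mono_left nhdsGT_le
  have leading_tendsto : Tendsto (fun q : ℝ × ℂ => (q.2 ^ m * G (q.1 * q.2)).re)
      (𝓝[>] 0 ×ˢ 𝓝 c) (𝓝 (c ^ m).re) := by
    have mul_G_tendsto := snd_tendsto.mul (hG.continuousAt.tendsto.comp mul_tendsto)
    rw [hG0, mul_one] at mul_G_tendsto
    exact (Complex.continuous_re.tendsto _).comp mul_G_tendsto
  filter_upwards [mul_tendsto.eventually hFG, leading_tendsto.eventually_lt_const hc,
    prod_mem_prod self_mem_nhdsWithin univ_mem] with q hq hneg hpos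
  have pow_pos : 0 < q.1 ^ m := pow_pos hpos.1 m
  rw [hq, mul_pow, mul_assoc, ← Complex.ofReal_pow, Complex.re_ofReal_mul]
  exact mul_neg_of_pos_of_neg pow_pos hneg

theorem eventually_forall_segment_mul {p : ℂ → Prop} {c : ℂ} {W : ℂ → ℂ} (hW : HasDerivAt W c 0)
    (hW0 : W 0 = 0) (hp : ∀ᶠ q : ℝ × ℂ in 𝓝[>] 0 ×ˢ 𝓝 c, p (q.1 * q.2)) :
    ∀ᶠ δ : ℝ in 𝓝[>] 0, ∀ t ∈ segment ℝ (W δ) (δ * c), p t := by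
  obtain ⟨S, hS, B, hB, hSB⟩ := eventually_prod_iff.1 hp
  obtain ⟨r, hr, hball⟩ := Metric.eventually_nhds_iff_ball.1 hB
  have slope_tendsto : Tendsto (fun δ : ℝ => (δ : ℂ)⁻¹ * W δ) (𝓝[>] 0) (𝓝 c) := by
    simpa [hW0] using hW.comp_ofReal.tendsto_slope_zero_right
  filter_upwards [hS, self_mem_nhdsWithin, slope_tendsto (Metric.ball_mem_nhds c hr)]
    with δ hδ (δ_pos : 0 < δ) hslope
  rintro _ ⟨α, β, hα, hβ, hαβ, rfl⟩
  have combination_eq : α • W δ + β • (δ * c) = δ * (α • ((δ : ℂ)⁻¹ * W δ) + β • c) := by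
    have := Complex.ofReal_ne_zero.2 δ_pos.ne'
    simp only [Complex.real_smul]
    field_simp
  rw [combination_eq]
  exact hSB hδ (hball _ (convex_ball c r hslope (Metric.mem_ball_self hr) hα hβ hαβ))

end DescentDirection

section ContourPieces

variable {lam : ℝ} {P : ℝ → ℂ → ℂ} {U : ℂ → ℂ}

/-- The value `h(u₀)` of the phase at the double saddle, as a real number. -/
noncomputable def saddleValue (lam : ℝ) : ℝ :=
  (phase lam (coalescenceRatio lam) (doubleSaddle lam)).re

/-- The point `u₀ + rayEnd` at which the ray of angle `π / 3` from the double saddle `u₀` meets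
the horizontal line of height `π / 2`. -/
noncomputable def rayEnd : ℂ := ((π / (2 * √3) : ℝ) : ℂ) + (π / 2 : ℝ) * Complex.I

theorem rayEnd_eq : rayEnd = ((π / (2 * √3) : ℝ) : ℂ) * (1 + √3 * Complex.I) := by
  have height_eq : (π / 2 : ℝ) = π / (2 * √3) * √3 := by field_simp
  rw [rayEnd, height_eq]
  push_cast
  ring

theorem branchSlope_eq (lam : ℝ) : branchSlope lam =
    (((2 : ℝ) ^ (2 / 3 : ℝ) / bigH lam ^ (1 / 3 : ℝ) / 2 : ℝ) : ℂ) * (1 + √3 * Complex.I) := by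
  have angle_eq : (π : ℂ) * Complex.I / 3 = ((π / 3 : ℝ) : ℂ) * Complex.I := by push_cast; ring
  rw [branchSlope, angle_eq, Complex.exp_mul_I, ← Complex.ofReal_cos, ← Complex.ofReal_sin,
    Real.cos_pi_div_three, Real.sin_pi_div_three]
  push_cast
  ring

theorem re_phase_doubleSaddle_add (hlam : 0 < lam) (t : ℂ) :
    (phase lam (coalescenceRatio lam) (doubleSaddle lam + t)).re =
      saddleValue lam + bigH lam / 12 * (normalizedPhase lam t).re := by
  have scale_eq : (bigH lam : ℂ) / 12 = ((bigH lam / 12 : ℝ) : ℂ) := by push_cast; rfl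
  rw [phase_doubleSaddle_add hlam, Complex.add_re, scale_eq, Complex.re_ofReal_mul, saddleValue]

theorem primitive_doubleSaddle_add_sub_isBigO (hlam : 0 < lam)
    (hP : ∀ x u, HasDerivAt (P x) (Complex.exp (x * phase lam (coalescenceRatio lam) u)) u)
    {A B : ℂ} (hneg : ∀ t ∈ segment ℝ A B, (normalizedPhase lam t).re < 0) (s : ℝ) :
    (fun x => P x (doubleSaddle lam + B) - P x (doubleSaddle lam + A)) =O[atTop]
      fun x => Real.exp (x * saddleValue lam) * x ^ s := by
  refine primitive_sub_isBigO_of_segment (differentiable_phase lam _).continuous.continuousOn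
    (fun u hu => ?_) (fun x u _ => hP x u) s
  rw [← segment_translate_image, mem_image] at hu
  obtain ⟨t, ht, rfl⟩ := hu
  rw [re_phase_doubleSaddle_add hlam]
  linarith [mul_neg_of_pos_of_neg (div_pos (bigH_pos hlam) (by norm_num : (0 : ℝ) < 12))
    (hneg t ht)]

theorem re_branchSlope_pow_three_neg (hlam : 0 < lam) : (branchSlope lam ^ 3).re < 0 := by
  have := congr_arg Complex.re (bigH_mul_branchSlope_pow_three hlam)
  rw [Complex.re_ofReal_mul] at this
  exact neg_of_mul_neg_right (this.trans_lt (by norm_num)) (bigH_pos hlam).le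

theorem eventually_primitive_tangent_sub_isBigO (hlam : 0 < lam)
    (hP : ∀ x u, HasDerivAt (P x) (Complex.exp (x * phase lam (coalescenceRatio lam) u)) u)
    (hU : IsUpperBranch lam (coalescenceRatio lam) U) (s : ℝ) :
    ∀ᶠ δ : ℝ in 𝓝[>] 0,
      (fun x => P x (doubleSaddle lam + δ * branchSlope lam) - P x (U δ)) =O[atTop]
        fun x => Real.exp (x * saddleValue lam) * x ^ s := by
  have sub_hasDerivAt : HasDerivAt (fun w => U w - doubleSaddle lam) (branchSlope lam) 0 :=
    (hU.deriv_zero ▸ hU.analyticAt.differentiableAt.hasDerivAt).sub_const _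
  have neg_of_near : ∀ᶠ q : ℝ × ℂ in 𝓝[>] 0 ×ˢ 𝓝 (branchSlope lam),
      (normalizedPhase lam (q.1 * q.2)).re < 0 :=
    eventually_re_neg_of_re_pow_neg ((differentiable_normalizedPhase lam).analyticAt 0)
      (fun _ => iteratedDeriv_normalizedPhase_zero_of_lt_three hlam)
      (iteratedDeriv_three_normalizedPhase_zero hlam) (re_branchSlope_pow_three_neg hlam)
  filter_upwards [eventually_forall_segment_mul (p := fun t => (normalizedPhase lam t).re < 0)
    sub_hasDerivAt (sub_eq_zero.2 hU.map_zero) neg_of_near] with δ hδ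
  simpa only [add_sub_cancel] using primitive_doubleSaddle_add_sub_isBigO hlam hP hδ s

theorem eventually_primitive_rayEnd_sub_isBigO (hlam : 0 < lam)
    (hP : ∀ x u, HasDerivAt (P x) (Complex.exp (x * phase lam (coalescenceRatio lam) u)) u)
    (s : ℝ) : ∀ᶠ δ : ℝ in 𝓝[>] 0,
      (fun x => P x (doubleSaddle lam + rayEnd) - P x (doubleSaddle lam + δ * branchSlope lam))
        =O[atTop] fun x => Real.exp (x * saddleValue lam) * x ^ s := by
  set κ : ℝ := (2 : ℝ) ^ (2 / 3 : ℝ) / bigH lam ^ (1 / 3 : ℝ) / 2 with hκ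
  have κ_pos : 0 < κ := by have := bigH_pos hlam; positivity
  have radius_le : ∀ᶠ δ : ℝ in 𝓝[>] 0, δ * κ ≤ π / (2 * √3) :=
    (Continuous.tendsto' (by fun_prop) 0 0 (zero_mul κ)).mono_left nhdsWithin_le_nhds
      |>.eventually_le_const (by positivity)
  filter_upwards [radius_le, self_mem_nhdsWithin] with δ hδ (δ_pos : 0 < δ)
  refine primitive_doubleSaddle_add_sub_isBigO hlam hP ?_ s
  have start_eq : (δ : ℂ) * branchSlope lam = ((δ * κ : ℝ) : ℂ) * (1 + √3 * Complex.I) := by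
    rw [branchSlope_eq, ← hκ]
    push_cast
    ring
  rw [start_eq, rayEnd_eq]
  rintro _ ⟨α, β, hα, hβ, hαβ, rfl⟩
  have radius_mem : α * (δ * κ) + β * (π / (2 * √3)) ∈ Ioc 0 (π / (2 * √3)) :=
    convex_Ioc 0 _ ⟨mul_pos δ_pos κ_pos, hδ⟩ ⟨by positivity, le_rfl⟩ hα hβ hαβ
  convert re_normalizedPhase_ray_neg hlam radius_mem using 3
  simp only [Complex.real_smul]
  push_cast
  ring

theorem re_normalizedPhase_rayEnd_neg (hlam : 0 < lam) : (normalizedPhase lam rayEnd).re < 0 := by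
  rw [rayEnd_eq]
  exact re_normalizedPhase_ray_neg hlam ⟨by positivity, le_rfl⟩

theorem re_phase_horizontal_le (hlam : 0 < lam) {ρ : ℝ}
    (hρ : doubleSaddle lam + π / (2 * √3) ≤ ρ) :
    (phase lam (coalescenceRatio lam) (ρ + (π / 2 : ℝ) * Complex.I)).re ≤
      saddleValue lam + bigH lam / 12 * (normalizedPhase lam rayEnd).re -
        bigH lam / 12 * (6 / (1 + lam)) * (ρ - (doubleSaddle lam + π / (2 * √3))) := by
  have bigH_pos := bigH_pos hlam
  have point_eq : (ρ : ℂ) + (π / 2 : ℝ) * Complex.I =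
      doubleSaddle lam + ((ρ - doubleSaddle lam : ℝ) + (π / 2 : ℝ) * Complex.I) := by
    push_cast
    ring
  rw [point_eq, re_phase_doubleSaddle_add hlam]
  calc _ ≤ saddleValue lam + bigH lam / 12 * ((normalizedPhase lam rayEnd).re -
        6 / (1 + lam) * (ρ - doubleSaddle lam - π / (2 * √3))) := by
        gcongr
        exact re_normalizedPhase_horizontal_le hlam (by positivity) (by linarith)
    _ = _ := by ring

theorem exists_tendsto_primitive_sub_rayEnd_isBigO (hlam : 0 < lam)
    (hP : ∀ x u, HasDerivAt (P x) (Complex.exp (x * phase lam (coalescenceRatio lam) u)) u)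
    (s : ℝ) : ∃ L : ℝ → ℂ,
      (∀ x ≥ 1, Tendsto (fun ρ : ℝ => P x (ρ + (π / 2 : ℝ) * Complex.I)) atTop (𝓝 (L x))) ∧
      (fun x => L x - P x (doubleSaddle lam + rayEnd)) =O[atTop]
        fun x => Real.exp (x * saddleValue lam) * x ^ s := by
  have bigH_pos := bigH_pos hlam
  have rate_pos : 0 < bigH lam / 12 * (6 / (1 + lam)) := by positivity
  choose! L hL hLb using fun x (hx : 1 ≤ x) =>
    exists_tendsto_primitive_horizontal rate_pos hx (hP x)
      fun ρ hρ => re_phase_horizontal_le hlam (mem_Ioi.1 hρ).le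
  have rayEnd_eq_add : (doubleSaddle lam : ℂ) + rayEnd =
      (doubleSaddle lam + π / (2 * √3) : ℝ) + (π / 2 : ℝ) * Complex.I := by
    rw [rayEnd]
    push_cast
    ring
  have value_lt : saddleValue lam + bigH lam / 12 * (normalizedPhase lam rayEnd).re <
      saddleValue lam := by
    linarith [mul_neg_of_pos_of_neg (div_pos bigH_pos (by norm_num : (0 : ℝ) < 12))
      (re_normalizedPhase_rayEnd_neg hlam)]
  refine ⟨L, hL, IsBigO.trans ?_ (isBigO_exp_mul_of_lt value_lt s)⟩
  refine IsBigO.of_bound (bigH lam / 12 * (6 / (1 + lam)))⁻¹ ?_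
  filter_upwards [eventually_ge_atTop 1] with x hx
  rw [rayEnd_eq_add, Real.norm_of_nonneg (Real.exp_pos _).le, inv_mul_eq_div]
  exact hLb x hx

end ContourPieces

section BranchIntegral

variable {h U : ℂ → ℂ}

theorem eventually_forall_Icc_ofReal {p : ℂ → Prop} (hp : ∀ᶠ w in 𝓝 0, p w) :
    ∀ᶠ δ : ℝ in 𝓝[>] 0, ∀ w ∈ Icc 0 δ, p (w : ℂ) := by
  obtain ⟨r, hr, hball⟩ := Metric.eventually_nhds_iff_ball.1 hp
  filter_upwards [Ioo_mem_nhdsGT hr] with δ hδ w hw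
  refine hball _ ?_
  rw [mem_ball_zero_iff, Complex.norm_real, Real.norm_of_nonneg hw.1]
  exact hw.2.trans_lt hδ.2

theorem isBigO_div_rpow {c : ℝ} (hc : 0 ≤ c) (s : ℝ) :
    (fun x : ℝ => (x / c) ^ s) =O[atTop] fun x => x ^ s := by
  refine IsBigO.of_bound (c⁻¹ ^ s) ((eventually_ge_atTop 0).mono fun x hx => ?_)
  rw [div_eq_inv_mul, Real.mul_rpow (by positivity) hx, norm_mul,
    Real.norm_of_nonneg (by positivity)]

theorem continuousOn_deriv_ofReal {s : Set ℝ} (hU : ∀ w ∈ s, AnalyticAt ℂ U (w : ℂ)) :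
    ContinuousOn (fun w : ℝ => deriv U w) s := fun w hw =>
  ((hU w hw).deriv.continuousAt.comp Complex.continuous_ofReal.continuousAt).continuousWithinAt

theorem primitive_sub_eq_integral_exp_cube {P : ℂ → ℂ} {h₀ x δ : ℝ} (hδ : 0 ≤ δ)
    (hP : ∀ u, HasDerivAt P (Complex.exp (x * h u)) u)
    (hU : ∀ w ∈ Icc 0 δ, AnalyticAt ℂ U (w : ℂ))
    (hphase : ∀ w ∈ Icc 0 δ, h (U w) - h₀ = -(w : ℂ) ^ 3 / 3) :
    P (U δ) - P (U 0) = Real.exp (x * h₀) •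
      ∫ w in (0 : ℝ)..δ, Real.exp (-(x / 3) * w ^ (3 : ℝ)) • deriv U w := by
  rw [← uIcc_of_le hδ] at hU hphase
  have primitive_deriv : ∀ w ∈ uIcc 0 δ, HasDerivAt (fun w : ℝ => P (U w))
      (Real.exp (x * h₀) • Real.exp (-(x / 3) * w ^ (3 : ℝ)) • deriv U w) w := by
    intro w hw
    refine ((hP (U w)).comp (w : ℂ)
      (hU w hw).differentiableAt.hasDerivAt).comp_ofReal.congr_deriv ?_
    have exponent_eq : (x : ℂ) * h (U w) = ((x * h₀ + -(x / 3) * w ^ 3 : ℝ) : ℂ) := by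
      rw [sub_eq_iff_eq_add.1 (hphase w hw)]
      push_cast
      ring
    rw [exponent_eq, smul_smul, Real.rpow_ofNat, ← Real.exp_add, Complex.real_smul,
      Complex.ofReal_exp]
  have exp_continuous : Continuous fun w : ℝ => Real.exp (-(x / 3) * w ^ (3 : ℝ)) :=
    Real.continuous_exp.comp
      (continuous_const.mul (Real.continuous_rpow_const (by norm_num)))
  have integrand_continuousOn : ContinuousOn (fun w : ℝ =>
      Real.exp (x * h₀) • Real.exp (-(x / 3) * w ^ (3 : ℝ)) • deriv U w) (uIcc 0 δ) :=
    (exp_continuous.continuousOn.smul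
      (continuousOn_deriv_ofReal hU)).const_smul (Real.exp (x * h₀))
  rw [← intervalIntegral.integral_smul, intervalIntegral.integral_eq_sub_of_hasDerivAt
    primitive_deriv integrand_continuousOn.intervalIntegrable, Complex.ofReal_zero]

theorem exists_norm_sub_partialSum_le {f : ℂ → ℂ} {c : ℕ → ℂ}
    (hf : ∀ᶠ z in 𝓝 0, HasSum (fun k => c k * z ^ k) (f z)) (N : ℕ) :
    ∃ C : ℝ, ∀ᶠ z in 𝓝 (0 : ℂ),
      ‖f z - ∑ k ∈ Finset.range N, c k * z ^ k‖ ≤ C * ‖z‖ ^ N := by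
  have hasSeries : HasFPowerSeriesAt f (FormalMultilinearSeries.ofScalars ℂ c) 0 := by
    rw [hasFPowerSeriesAt_iff]
    filter_upwards [hf] with z hz
    simpa [mul_comm] using hz
  obtain ⟨C, hC⟩ := (hasSeries.isBigO_sub_partialSum_pow N).bound
  refine ⟨C, hC.mono fun z hz => ?_⟩
  simpa [FormalMultilinearSeries.partialSum, mul_comm] using hz

theorem eventually_primitive_branch_sub_isBigO {P : ℝ → ℂ → ℂ} {h₀ : ℝ} {c : ℕ → ℂ}
    (hP : ∀ x : ℝ, ∀ u, HasDerivAt (P x) (Complex.exp (x * h u)) u) (hU : AnalyticAt ℂ U 0)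
    (hphase : ∀ᶠ w in 𝓝 0, h (U w) - h₀ = -w ^ 3 / 3)
    (hc : ∀ᶠ w in 𝓝 0, HasSum (fun k => c k * w ^ k) (deriv U w)) (N : ℕ) :
    ∀ᶠ δ : ℝ in 𝓝[>] 0,
      (fun x => P x (U δ) - P x (U 0) -
        Real.exp (x * h₀) • ∑ k ∈ Finset.range N, watsonMoment 3 k (x / 3) • c k)
      =O[atTop] fun x => Real.exp (x * h₀) * x ^ (-((N : ℝ) + 1) / 3) := by
  obtain ⟨C, hC⟩ := exists_norm_sub_partialSum_le hc N
  filter_upwards [eventually_forall_Icc_ofReal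
    (hU.eventually_analyticAt.and (hphase.and hC)), self_mem_nhdsWithin] with δ hδ δ_pos
  have deriv_integrable : IntegrableOn (fun w : ℝ => deriv U w) (Ioc 0 δ) :=
    ((continuousOn_deriv_ofReal fun w hw => (hδ w hw).1).integrableOn_Icc).mono_set
      Ioc_subset_Icc_self
  have remainder_le : ∀ w ∈ Ioc 0 δ,
      ‖deriv U w - ∑ k ∈ Finset.range N, w ^ k • c k‖ ≤ C * w ^ N := fun w hw => by
    simpa [mul_comm, abs_of_pos hw.1] using (hδ w (Ioc_subset_Icc_self hw)).2.2
  have watson := (watson_isBigO three_pos δ_pos deriv_integrable remainder_le).comp_tendsto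
    (tendsto_id.atTop_div_const three_pos)
  refine ((isBigO_refl (fun x => Real.exp (x * h₀)) atTop).smul
    (watson.trans (isBigO_div_rpow three_pos.le _))).congr_left fun x => ?_
  rw [primitive_sub_eq_integral_exp_cube (le_of_lt δ_pos) (hP x) (fun w hw => (hδ w hw).1)
    fun w hw => (hδ w hw).2.1, ← smul_sub]
  rfl

end BranchIntegral

section SaddleExpansion

variable {lam : ℝ} {B : ℕ → ℝ}

/-- The Taylor coefficients of `du/dw` on the upper branch, expressed through the real numbers
`B k` of `IsSaddleCoeff`. -/
noncomputable def branchCoeff (lam : ℝ) (B : ℕ → ℝ) (k : ℕ) : ℂ :=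
  (((2 : ℝ) ^ (2 / 3 : ℝ) / bigH lam ^ (1 / 3 : ℝ) : ℝ) : ℂ) *
    (Complex.exp ((π : ℂ) * Complex.I * ((k : ℂ) + 1) / 3) *
      ((B k / bigH lam ^ ((k : ℝ) / 3) : ℝ) : ℂ))

theorem branchCoeff_im (lam : ℝ) (B : ℕ → ℝ) (k : ℕ) : (branchCoeff lam B k).im =
    (2 : ℝ) ^ (2 / 3 : ℝ) / bigH lam ^ (1 / 3 : ℝ) * (B k / bigH lam ^ ((k : ℝ) / 3)) *
      Real.sin (π / 3 * ((k : ℝ) + 1)) := by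
  have angle_eq : (π : ℂ) * Complex.I * ((k : ℂ) + 1) / 3 =
      ((π / 3 * ((k : ℝ) + 1) : ℝ) : ℂ) * Complex.I := by
    push_cast
    ring
  rw [branchCoeff, angle_eq, mul_comm (Complex.exp _), Complex.im_ofReal_mul,
    Complex.im_ofReal_mul, Complex.exp_ofReal_mul_I_im]
  ring

theorem exists_tendsto_primitive_isBigO (hlam : 0 < lam)
    (hB : IsSaddleCoeff lam (coalescenceRatio lam) B) {P : ℝ → ℂ → ℂ}
    (hP : ∀ x u, HasDerivAt (P x) (Complex.exp (x * phase lam (coalescenceRatio lam) u)) u)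
    (hP0 : ∀ x, P x (doubleSaddle lam) = 0) (N : ℕ) :
    ∃ L : ℝ → ℂ,
      (∀ x ≥ 1, Tendsto (fun ρ : ℝ => P x (ρ + (π / 2 : ℝ) * Complex.I)) atTop (𝓝 (L x))) ∧
      (fun x => L x - Real.exp (x * saddleValue lam) •
        ∑ k ∈ Finset.range N, watsonMoment 3 k (x / 3) • branchCoeff lam B k)
      =O[atTop] fun x => Real.exp (x * saddleValue lam) * x ^ (-((N : ℝ) + 1) / 3) := by
  obtain ⟨U, hU, hsum⟩ := hB
  have phase_eq : ∀ᶠ w in 𝓝 0,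
      phase lam (coalescenceRatio lam) (U w) - (saddleValue lam : ℂ) = -w ^ 3 / 3 := by
    rw [saddleValue, ← phase_ofReal]
    exact hU.phase_eq
  have deriv_hasSum : ∀ᶠ w in 𝓝 0, HasSum (fun k => branchCoeff lam B k * w ^ k) (deriv U w) := by
    simpa only [branchCoeff, mul_assoc] using hsum
  obtain ⟨L, hL, hend⟩ := exists_tendsto_primitive_sub_rayEnd_isBigO hlam hP (-((N : ℝ) + 1) / 3)
  obtain ⟨δ, branch, tangent, ray⟩ :=
    ((eventually_primitive_branch_sub_isBigO hP hU.analyticAt phase_eq deriv_hasSum N).and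
      ((eventually_primitive_tangent_sub_isBigO hlam hP hU _).and
        (eventually_primitive_rayEnd_sub_isBigO hlam hP _))).exists
  refine ⟨L, hL, (hend.add (ray.add (tangent.add branch))).congr_left fun x => ?_⟩
  rw [hU.map_zero, hP0]
  ring

theorem pi_mul_saddlePrefactor_mul_saddleTerm (hlam : 0 < lam) (B : ℕ → ℝ) (k : ℕ) {x : ℝ}
    (hx : 0 < x) :
    π * (saddlePrefactor lam (coalescenceRatio lam) x * saddleTerm lam B k x) =
      Real.exp (x * saddleValue lam) * (watsonMoment 3 k (x / 3) • branchCoeff lam B k).im := by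
  have bigH_pos := bigH_pos hlam
  have third_pos : 0 < x / 3 := by positivity
  have power_eq : (x / 3) ^ (-((k : ℝ) + 1) / 3) =
      ((x / 3) ^ (1 / 3 : ℝ) * (x / 3) ^ ((k : ℝ) / 3))⁻¹ := by
    rw [← Real.rpow_add third_pos, ← Real.rpow_neg third_pos.le]
    congr 1
    ring
  rw [Complex.smul_im, smul_eq_mul, branchCoeff_im, watsonMoment, saddlePrefactor, saddleTerm,
    mul_div_assoc (bigH lam), Real.mul_rpow bigH_pos.le third_pos.le,
    Real.mul_rpow bigH_pos.le third_pos.le, power_eq, ← saddleValue]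
  field_simp

theorem isBigO_saddlePrefactor (hlam : 0 < lam) (N : ℕ) :
    (fun x : ℝ => Real.exp (x * saddleValue lam) * x ^ (-((N : ℝ) + 1) / 3)) =O[atTop]
      fun x : ℝ => saddlePrefactor lam (coalescenceRatio lam) x *
        (bigH lam * x / 3) ^ (-(N : ℝ) / 3) := by
  have bigH_pos := bigH_pos hlam
  refine IsBigO.of_bound
    (3 * π / (2 : ℝ) ^ (2 / 3 : ℝ) * ((bigH lam / 3) ^ (-((N : ℝ) + 1) / 3))⁻¹) ?_
  filter_upwards [eventually_gt_atTop 0] with x hx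
  have variable_pos : 0 < bigH lam * x / 3 := by positivity
  have power_eq : (bigH lam * x / 3) ^ (-(N : ℝ) / 3) =
      (bigH lam / 3) ^ (-((N : ℝ) + 1) / 3) * x ^ (-((N : ℝ) + 1) / 3) *
        (bigH lam * x / 3) ^ (1 / 3 : ℝ) := by
    rw [← Real.mul_rpow (by positivity) hx.le, div_mul_eq_mul_div, ← Real.rpow_add variable_pos]
    congr 1
    ring
  rw [saddlePrefactor, ← saddleValue, Real.norm_of_nonneg (by positivity),
    Real.norm_of_nonneg (by positivity), power_eq]
  refine le_of_eq ?_
  field_simp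

theorem wrightMinus_isBigO (hlam : 0 < lam) (hB : IsSaddleCoeff lam (coalescenceRatio lam) B)
    (N : ℕ) :
    (fun x : ℝ => wrightMinus lam (coalescenceRatio lam * x) x -
      saddlePrefactor lam (coalescenceRatio lam) x *
        ∑ k ∈ Finset.range N, saddleTerm lam B k x) =O[atTop]
    fun x : ℝ => saddlePrefactor lam (coalescenceRatio lam) x *
      (bigH lam * x / 3) ^ (-(N : ℝ) / 3) := by
  choose P hP0 hP hconj using fun x : ℝ => exists_primitive_conj
    (f := fun u => Complex.exp (x * phase lam (coalescenceRatio lam) u))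
    (((differentiable_phase lam _).const_mul _).cexp)
    (fun u => by rw [phase_conj, ← Complex.exp_conj, map_mul, Complex.conj_ofReal])
    (doubleSaddle lam)
  obtain ⟨L, hL, hbound⟩ := exists_tendsto_primitive_isBigO hlam hB hP hP0 N
  refine IsBigO.trans (IsBigO.of_bound π⁻¹ ?_) (hbound.trans (isBigO_saddlePrefactor hlam N))
  filter_upwards [eventually_ge_atTop 1] with x hx
  have x_pos : 0 < x := by linarith
  have im_eq : π * (wrightMinus lam (coalescenceRatio lam * x) x -
      saddlePrefactor lam (coalescenceRatio lam) x *
        ∑ k ∈ Finset.range N, saddleTerm lam B k x) =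
      (L x - Real.exp (x * saddleValue lam) •
        ∑ k ∈ Finset.range N, watsonMoment 3 k (x / 3) • branchCoeff lam B k).im := by
    rw [mul_sub, pi_mul_wrightMinus hlam.le (coalescenceRatio_pos hlam) x_pos (hP x) (hconj x)
      (hL x hx), Complex.sub_im, Complex.smul_im, Complex.im_sum, Finset.mul_sum, smul_eq_mul,
      Finset.mul_sum, Finset.mul_sum]
    simp only [pi_mul_saddlePrefactor_mul_saddleTerm hlam B _ x_pos]
  rw [inv_mul_eq_div, le_div_iff₀ Real.pi_pos, mul_comm, ← Real.norm_of_nonneg Real.pi_pos.le,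
    ← norm_mul, im_eq, Real.norm_eq_abs]
  exact Complex.abs_im_le_norm _

theorem saddleTerm_eq_zero (lam : ℝ) (B : ℕ → ℝ) {k : ℕ} (hk : k % 3 = 2) (x : ℝ) :
    saddleTerm lam B k x = 0 := by
  obtain ⟨m, rfl⟩ : ∃ m, k = 3 * m + 2 := ⟨k / 3, by omega⟩
  have angle_eq : π / 3 * (((3 * m + 2 : ℕ) : ℝ) + 1) = ((m + 1 : ℕ) : ℝ) * π := by
    push_cast
    ring
  rw [saddleTerm, angle_eq, Real.sin_nat_mul_pi, mul_zero]

end SaddleExpansion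

theorem mainTheorem3 (lam a : ℝ) (hlam : 0 < lam)
    (ha : a = (1 + lam) / 2 * lam ^ ((1 - lam) / (1 + lam))) :
    -- double saddle point
    deriv (phase lam a) (doubleSaddle lam : ℂ) = 0 ∧
    iteratedDeriv 2 (phase lam a) (doubleSaddle lam : ℂ) = 0 ∧
    (bigH lam : ℂ) = 2 * iteratedDeriv 3 (phase lam a) (doubleSaddle lam : ℂ) ∧
    phase lam a (doubleSaddle lam : ℂ) =
      (((lam ^ 2 - 1) / (2 * lam ^ 2) * Real.exp (doubleSaddle lam) -
        lam ^ ((1 - lam) / (1 + lam)) * Real.log lam : ℝ) : ℂ) ∧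
    -- coefficients
    ∃ B : ℕ → ℝ, IsSaddleCoeff lam a B ∧
      B 0 = 1 ∧
      B 1 = (lam - 1) / ((2 : ℝ) ^ (1 / 3 : ℝ) * 3) ∧
      B 2 = (1 - 6 * lam + lam ^ 2) / ((2 : ℝ) ^ (2 / 3 : ℝ) * 20) ∧
      B 3 = (5 + 93 * lam - 93 * lam ^ 2 - 5 * lam ^ 3) / 1620 ∧
      B 4 = -(277 + 836 * lam - 6114 * lam ^ 2 + 836 * lam ^ 3 + 277 * lam ^ 4) /
        ((2 : ℝ) ^ (1 / 3 : ℝ) * 136080) ∧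
      B 5 = (1 - 61 * lam - 254 * lam ^ 2 + 254 * lam ^ 3 + 61 * lam ^ 4 - lam ^ 5) /
        ((2 : ℝ) ^ (2 / 3 : ℝ) * 16800) ∧
      B 6 = (959 + 7098 * lam - 2031 * lam ^ 2 - 58708 * lam ^ 3 - 2031 * lam ^ 4 +
        7098 * lam ^ 5 + 959 * lam ^ 6) / 10497600 ∧
      -- asymptotic expansion as `x → +∞` with `ν = a x`
      (∀ N : ℕ,
        (fun x : ℝ => wrightMinus lam (a * x) x -
          saddlePrefactor lam a x * ∑ k ∈ Finset.range N, saddleTerm lam B k x)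
        =O[atTop]
        (fun x : ℝ => saddlePrefactor lam a x * (bigH lam * x / 3) ^ (-(N : ℝ) / 3))) ∧
      -- vanishing terms
      (∀ k : ℕ, k % 3 = 2 → ∀ x : ℝ, saddleTerm lam B k x = 0) := by
  obtain rfl : a = coalescenceRatio lam := ha
  obtain ⟨T, hT⟩ := exists_isCubicInverse hlam
  have hB := hT.isSaddleCoeff hlam
  obtain ⟨hB0, hB1, hB2, hB3, hB4, hB5, hB6⟩ := hT.saddleCoeff_eq hlam
  exact ⟨deriv_phase_doubleSaddle hlam, iteratedDeriv_two_phase_doubleSaddle hlam _,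
    bigH_eq_two_mul_iteratedDeriv_three_phase hlam _, phase_doubleSaddle hlam,
    saddleCoeff T, hB, hB0, hB1, hB2, hB3, hB4, hB5, hB6, wrightMinus_isBigO hlam hB,
    fun k hk x => saddleTerm_eq_zero lam _ hk x⟩
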